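/- Let $n\ge 1$ and consider the time-varying single-output triangular system $$\dot x_i=f_i(t,x_1,\dots,x_{i+1}),\quad i=1,\dots,n-1,\qquad \dot x_n=f_n(t,x_1,\dots,x_n),\qquad y=x_1,\qquad t\ge 0,\ x\in\mathbb R^n, \tag{1}$$ where the functions $f_i$ are continuous on their domains ($t\ge 0$) and locally Lipschitz in the state, locally uniformly in $t$. Assume: - (H1) for all $i=1,\dots,n-1$ and all $(t;x_1,\dots,x_i)\in\mathbb R_{\ge 0}\times\mathbb R^i$, the function $\mathbb R\ni z\mapsto f_i(t,x_1,\dots,x_i,z)$ is strictly monotone (strictly increasing or strictly decreasing); - the system is forward complete: for all $t_0\ge 0$, $x_0\in\mathbb R^n$ the solution $x(\cdot)=x(\cdot,t_0,x_0)$ with $x(t_0)=x_0$ exists on $[t_0,\infty)$. For $\emptyset\neq M\subset\mathbb R^n$ and $t_0\ge 0$ let $O(t_0,M)$ be the set of outputs $y(t)=x_1(t,t_0,x_0)$, $t\ge t_0$, with $x_0\in M$. Then: (i) The switching observer design problem is solvable for (1) with respect to $\mathbb R^n$. That is, for every $t_0\ge 0$ there are times $(t_k)_{k\ge 1}$, strictly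 increasing, with $t_1=t_0$ and $t_k\to\infty$, continuous maps $G_k:[t_{k-1},t_{k+1}]\times\mathbb R^n\times\mathbb R\to\mathbb R^n$, $k=1,2,\dots$, and a nonempty set $\bar M\subset\mathbb R^n$ such that for every $y\in O(t_0,\mathbb R^n)$ and every choice of initial values $z_k(t_{k-1})\in\bar M$ the (unique) solution $z_k$ of $\dot z_k=G_k(t,z_k,y(t))$ is defined on all of $[t_{k-1},t_{k+1}]$ for every $k\ge 1$, and the map $Z:[t_0,\infty)\to\mathbb R^n$, $Z(t):=z_k(t)$ for $t\in[t_k,t_{k+1})$, satisfies $\lim_{t\to\infty}(x(t)-Z(t))=0$ for every solution $x$ of (1) on $[t_0,\infty)$ whose output is $y$. (ii) For every $R>0$ the observer design problem is solvable for (1) with respect to the closed Euclidean ball $B_R$ of radius $R$ centered at $0$ (the initial states being known to lie in $B_R$). That is, for every $t_0\ge 0$ there are a continuous map $G:[t_0,\infty)\times\mathbb R^n\times\mathbb R\to\mathbb R^n$ and a nonempty set $\bar M\subset\mathbb R^n$ such that for every $z_0\in\bar M$ and $y\in O(t_0,B_R)$ the (unique) solution $z$ of $\dot z=G(t,z,y(t))$,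 $z(t_0)=z_0$, exists on all of $[t_0,\infty)$ and $\lim_{t\to\infty}(x(t)-z(t))=0$ for every solution $x$ of (1) on $[t_0,\infty)$ with $x(t_0)\in B_R$ whose output is $y$. -/

import Mathlib

open Set Filter Topology
open scoped NNReal

namespace ObserverDesign

section General

variable {E Y : Type*} [NormedAddCommGroup E] [NormedSpace ℝ E]

/-- `x` solves `ẋ = F(t, x)` on the set `I` of times (one-sided derivatives at the end points
of an interval `I` that belong to it). -/
def IsSolutionOn (F : ℝ → E → E) (I : Set ℝ) (x : ℝ → E) : Prop :=
  ∀ t ∈ I, HasDerivWithinAt x (F t (x t)) I t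

/-- `z` is *the* solution of `ż = F(t, z)`, `z(t₀) = z₀`, and it is defined on the whole interval
`I` (whose left end point is `t₀`): `z` is a solution on `I`, and every solution of the same
initial value problem on a subinterval `[t₀, T] ⊆ I` coincides with `z` there. -/
def IsTheSolutionOn (F : ℝ → E → E) (t₀ : ℝ) (z₀ : E) (I : Set ℝ) (z : ℝ → E) : Prop :=
  z t₀ = z₀ ∧ IsSolutionOn F I z ∧
    ∀ T : ℝ, Icc t₀ T ⊆ I → ∀ w : ℝ → E, w t₀ = z₀ → IsSolutionOn F (Icc t₀ T) w →
      EqOn w z (Icc t₀ T)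

/-- Forward completeness of `ẋ = f(t, x)`, `(t, x) ∈ ℝ≥0 × E`: from every initial time `t₀ ≥ 0` and
every initial state there is a solution on all of `[t₀, ∞)`. -/
def ForwardComplete (f : ℝ → E → E) : Prop :=
  ∀ t₀ : ℝ, 0 ≤ t₀ → ∀ x₀ : E, ∃ x : ℝ → E, x t₀ = x₀ ∧ IsSolutionOn f (Ici t₀) x

/-- `f : ℝ≥0 × E → E` is locally Lipschitz in the state, locally uniformly in time. -/
def LocallyLipschitzInState (f : ℝ → E → E) : Prop :=
  ∀ t : ℝ, 0 ≤ t → ∀ x : E, ∃ K : ℝ≥0, ∃ ε : ℝ, 0 < ε ∧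
    ∀ s : ℝ, 0 ≤ s → |s - t| < ε → LipschitzOnWith K (f s) (Metric.ball x ε)

/-- `x` is a trajectory of `ẋ = f(t, x)` on `[t₀, ∞)` with initial state in `M`, and `y` is the
corresponding output `y(t) = h(t, x(t))`, `t ≥ t₀`. -/
def IsTrajectoryWithOutput (f : ℝ → E → E) (h : ℝ → E → Y) (t₀ : ℝ) (M : Set E)
    (x : ℝ → E) (y : ℝ → Y) : Prop :=
  x t₀ ∈ M ∧ IsSolutionOn f (Ici t₀) x ∧ ∀ t : ℝ, t₀ ≤ t → y t = h t (x t)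

/-- The set `O(t₀, M)` of outputs of `ẋ = f(t, x)`, `y = h(t, x)` with initial time `t₀` and initial
state in `M`. (Only the values on `[t₀, ∞)` of an output are ever used.) -/
def outputSet (f : ℝ → E → E) (h : ℝ → E → Y) (t₀ : ℝ) (M : Set E) : Set (ℝ → Y) :=
  {y | ∃ x : ℝ → E, IsTrajectoryWithOutput f h t₀ M x y}

variable [TopologicalSpace Y]

/-- The Observer Design Problem for `ẋ = f(t, x)`, `y = h(t, x)` is solvable with respect to `M`. -/
def ODPSolvable (f : ℝ → E → E) (h : ℝ → E → Y) (M : Set E) : Prop :=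
  ∀ t₀ : ℝ, 0 ≤ t₀ →
    ∃ G : ℝ → E → Y → E,
      ContinuousOn (fun p : ℝ × E × Y => G p.1 p.2.1 p.2.2) (Ici t₀ ×ˢ univ) ∧
    ∃ Mbar : Set E, Mbar.Nonempty ∧
      ∀ z₀ ∈ Mbar, ∀ y ∈ outputSet f h t₀ M,
        ∃ z : ℝ → E, IsTheSolutionOn (fun t ζ => G t ζ (y t)) t₀ z₀ (Ici t₀) z ∧
          ∀ x : ℝ → E, IsTrajectoryWithOutput f h t₀ M x y →
            Tendsto (fun t => x t - z t) atTop (𝓝 0)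

/-- The Switching Observer Design Problem for `ẋ = f(t, x)`, `y = h(t, x)` is solvable with respect
to `M`. The switching times are `t₀ = τ 0 = τ 1 < τ 2 < ⋯ → ∞`; for `k ≥ 1` the `k`-th observer runs
on `[τ (k - 1), τ (k + 1)]`, starts in an arbitrary point of `Mbar`, and supplies the estimate `Z`
on `[τ k, τ (k + 1))`. -/
def SODPSolvable (f : ℝ → E → E) (h : ℝ → E → Y) (M : Set E) : Prop :=
  ∀ t₀ : ℝ, 0 ≤ t₀ →
    ∃ τ : ℕ → ℝ, τ 0 = t₀ ∧ τ 1 = t₀ ∧ StrictMonoOn τ (Ici 1) ∧ Tendsto τ atTop atTop ∧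
    ∃ G : ℕ → ℝ → E → Y → E,
      (∀ k : ℕ, 1 ≤ k → ContinuousOn (fun p : ℝ × E × Y => G k p.1 p.2.1 p.2.2)
        (Icc (τ (k - 1)) (τ (k + 1)) ×ˢ univ)) ∧
    ∃ Mbar : Set E, Mbar.Nonempty ∧
      ∀ ζ₀ : ℕ → E, (∀ k : ℕ, 1 ≤ k → ζ₀ k ∈ Mbar) → ∀ y ∈ outputSet f h t₀ M,
        ∃ z : ℕ → ℝ → E,
          (∀ k : ℕ, 1 ≤ k → IsTheSolutionOn (fun t ζ => G k t ζ (y t)) (τ (k - 1)) (ζ₀ k)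
            (Icc (τ (k - 1)) (τ (k + 1))) (z k)) ∧
          ∀ Z : ℝ → E, (∀ k : ℕ, 1 ≤ k → EqOn Z (z k) (Ico (τ k) (τ (k + 1)))) →
            ∀ x : ℝ → E, IsTrajectoryWithOutput f h t₀ M x y →
              Tendsto (fun t => x t - Z t) atTop (𝓝 0)

end General

section Triangular

variable {n : ℕ}

/-- Triangular structure: the component `fᵢ(t, x)` depends on `t` and `x₁, …, xᵢ₊₁` only (on `t` and
all of `x` for `i = n`). The coordinates are numbered from `0` here. -/
def IsTriangular (f : ℝ → EuclideanSpace ℝ (Fin n) → EuclideanSpace ℝ (Fin n)) : Prop :=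
  ∀ t : ℝ, 0 ≤ t → ∀ i : Fin n, ∀ x x' : EuclideanSpace ℝ (Fin n),
    (∀ j : Fin n, (j : ℕ) ≤ (i : ℕ) + 1 → x j = x' j) → f t x i = f t x' i

/-- For every `i = 1, …, n - 1`, every `t ≥ 0` and all values of the other variables, the function
`z ↦ fᵢ(t, x₁, …, xᵢ, z)` is strictly monotone (strictly increasing or strictly decreasing). -/
def StrictlyMonotoneInNext
    (f : ℝ → EuclideanSpace ℝ (Fin n) → EuclideanSpace ℝ (Fin n)) : Prop :=
  ∀ t : ℝ, 0 ≤ t → ∀ i j : Fin n, (j : ℕ) = (i : ℕ) + 1 → ∀ x : EuclideanSpace ℝ (Fin n),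
    StrictMono (fun z : ℝ => f t (WithLp.toLp 2 (Function.update x.ofLp j z)) i) ∨
    StrictAnti (fun z : ℝ => f t (WithLp.toLp 2 (Function.update x.ofLp j z)) i)

end Triangular

end ObserverDesign

namespace ObserverDesign

/-! ### Scalar relaxation equations -/

/-! The state is recovered one component at a time. If `x₁, …, xᵢ` are known, a fast filter `ż = k⁻³
(xᵢ - z)` follows `xᵢ`, and `k⁻³ (xᵢ - z)` approximates `ẋᵢ = fᵢ(t, x₁, …, xᵢ₊₁)`; strict
monotonicity then determines `xᵢ₊₁`.

Two things make this uniform over all trajectories. By forward completeness, the Lipschitz condition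
and compactness of balls, one function `b` satisfies `‖x t‖ ≤ (b t)⁻¹` for every trajectory from
some time on (`exists_eventual_bound`). All estimates are truncated at `(b t)⁻¹`, so filters started
at `0` obey the same bound, whenever they start. Secondly, the gains grow with time: on each compact
time interval the required smallness follows from uniform continuity, and `exists_isScale_forall`
glues these requirements into one slowly varying function.

The stages are `differentiator_window` (filtering), `exists_saturated_inverse` (inversion) and
`exists_isStage` (both together). Precisions are fixed backwards, from the last component to the
first (`exists_stages`). The cascade is solved one scalar linear equation at a time, so its
solutions exist globally and are unique although `G` is merely continuous. The resulting observer
(`exists_observer`) does not depend on the size of the initial state. Run once it gives (ii);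
restarted from `0` every `n` time units it gives (i). -/

lemma hasDerivWithinAt_Ici_of_Icc {E : Type*} [NormedAddCommGroup E] [NormedSpace ℝ E]
    {w : ℝ → E} {w' : E} {a b t : ℝ} (ht : t ∈ Ico a b)
    (h : HasDerivWithinAt w w' (Icc a b) t) : HasDerivWithinAt w w' (Ici t) t :=
  h.mono_of_mem_nhdsWithin (Icc_mem_nhdsGE_of_mem ht)

lemma le_of_damped {w k d : ℝ → ℝ} {a b k₀ D : ℝ} (hk₀ : 0 < k₀) (hD : 0 ≤ D)
    (hw : ∀ t ∈ Icc a b, HasDerivWithinAt w (-k t * w t + d t) (Icc a b) t)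
    (hk : ∀ t ∈ Icc a b, k₀ ≤ k t) (hd : ∀ t ∈ Icc a b, d t ≤ D) {t : ℝ} (ht : t ∈ Icc a b) :
    w t ≤ Real.exp (-k₀ * (t - a)) * |w a| + D / k₀ := by
  -- The slack `ε` makes the comparison strict. It is tested only where `w` meets the positive
  -- barrier, and there `k ≥ k₀` gives `k * w ≥ k₀ * w`.
  refine le_of_forall_pos_le_add fun ε hε => ?_
  have key := image_le_of_deriv_right_lt_deriv_boundary (f := w) (a := a) (b := b)
    (fun s hs => (hw s hs).continuousWithinAt)
    (fun s hs => hasDerivWithinAt_Ici_of_Icc hs (hw s ⟨hs.1, hs.2.le⟩))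
    (B := fun s => Real.exp (-k₀ * (s - a)) * |w a| + (D / k₀ + ε))
    (B' := fun s => Real.exp (-k₀ * (s - a)) * (-k₀ * 1) * |w a|)
    (by
      simp only [sub_self, mul_zero, Real.exp_zero, one_mul]
      have := le_abs_self (w a)
      have : 0 ≤ D / k₀ := by positivity
      linarith)
    (fun s => ((((hasDerivAt_id s).sub_const a).const_mul (-k₀)).exp.mul_const _).add_const _)
    (by
      intro s hs hws
      have hs' : s ∈ Icc a b := ⟨hs.1, hs.2.le⟩
      have h1 := hk s hs'
      have h2 := hd s hs'
      have h3 : 0 < w s := by rw [hws]; positivity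
      have h4 : k₀ * w s ≤ k s * w s := by gcongr
      have h5 : k₀ * w s = k₀ * (Real.exp (-k₀ * (s - a)) * |w a|) + D + k₀ * ε := by
        rw [hws]; field_simp; ring
      have h6 : 0 < k₀ * ε := by positivity
      linarith)
    ht
  linarith

lemma abs_le_of_damped {w k d : ℝ → ℝ} {a b k₀ D : ℝ} (hk₀ : 0 < k₀) (hD : 0 ≤ D)
    (hw : ∀ t ∈ Icc a b, HasDerivWithinAt w (-k t * w t + d t) (Icc a b) t)
    (hk : ∀ t ∈ Icc a b, k₀ ≤ k t) (hd : ∀ t ∈ Icc a b, |d t| ≤ D) {t : ℝ} (ht : t ∈ Icc a b) :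
    |w t| ≤ Real.exp (-k₀ * (t - a)) * |w a| + D / k₀ := by
  refine abs_le'.2 ⟨le_of_damped hk₀ hD hw hk (fun s hs => (abs_le.1 (hd s hs)).2) ht, ?_⟩
  have := le_of_damped (w := fun s => -w s) (d := fun s => -d s) hk₀ hD
    (fun s hs => (hw s hs).neg.congr_deriv (by ring)) hk
    (fun s hs => by linarith [(abs_le.1 (hd s hs)).1]) ht
  simpa using this

/-- Above the level `B` the right-hand side is negative. The bound is independent of the size of the
gain, so high gain causes no peaking of `z`. -/
lemma le_of_relaxation {z k u : ℝ → ℝ} {a b B : ℝ} (hk : ∀ t ∈ Icc a b, 0 < k t)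
    (hz : ∀ t ∈ Icc a b, HasDerivWithinAt z (k t * (u t - z t)) (Icc a b) t)
    (hu : ∀ t ∈ Icc a b, u t ≤ B) (ha : z a ≤ B) {t : ℝ} (ht : t ∈ Icc a b) : z t ≤ B := by
  refine le_of_forall_pos_le_add fun ε hε => ?_
  refine image_le_of_deriv_right_lt_deriv_boundary (f := z) (a := a) (b := b)
    (fun s hs => (hz s hs).continuousWithinAt)
    (fun s hs => hasDerivWithinAt_Ici_of_Icc hs (hz s ⟨hs.1, hs.2.le⟩))
    (B := fun _ => B + ε) (B' := fun _ => 0) (by linarith) (fun s => hasDerivAt_const _ _) ?_ ht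
  intro s hs hzs
  have hs' : s ∈ Icc a b := ⟨hs.1, hs.2.le⟩
  exact mul_neg_of_pos_of_neg (hk s hs') (by linarith [hu s hs'])

lemma abs_le_of_relaxation {z k u : ℝ → ℝ} {a b B : ℝ} (hk : ∀ t ∈ Icc a b, 0 < k t)
    (hz : ∀ t ∈ Icc a b, HasDerivWithinAt z (k t * (u t - z t)) (Icc a b) t)
    (hu : ∀ t ∈ Icc a b, |u t| ≤ B) (ha : |z a| ≤ B) {t : ℝ} (ht : t ∈ Icc a b) : |z t| ≤ B := by
  refine abs_le'.2 ⟨le_of_relaxation hk hz (fun s hs => (abs_le.1 (hu s hs)).2) (abs_le.1 ha).2 ht,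
    le_of_relaxation (z := fun s => -z s) (u := fun s => -u s) hk
      (fun s hs => (hz s hs).neg.congr_deriv (by ring))
      (fun s hs => by linarith [(abs_le.1 (hu s hs)).1]) (by linarith [(abs_le.1 ha).1]) ht⟩

/-- Variation of constants with the integrating factor `exp (∫ k)`. -/
lemma exists_relaxation {k u : ℝ → ℝ} (hk : Continuous k) (hu : Continuous u) (a z₀ : ℝ) :
    ∃ z : ℝ → ℝ, z a = z₀ ∧ ∀ t, HasDerivAt z (k t * (u t - z t)) t := by
  set A : ℝ → ℝ := fun t => ∫ s in a..t, k s with hA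
  have hAd : ∀ t, HasDerivAt A (k t) t := fun t => (hk.integral_hasStrictDerivAt a t).hasDerivAt
  have hAc : Continuous A := continuous_iff_continuousAt.2 fun t => (hAd t).continuousAt
  set v : ℝ → ℝ := fun s => k s * u s * Real.exp (A s) with hv
  have hvc : Continuous v := by fun_prop
  refine ⟨fun t => Real.exp (-A t) * (z₀ + ∫ s in a..t, v s), by simp [hA], fun t => ?_⟩
  have h1 := (hAd t).neg.exp.mul
    ((hvc.integral_hasStrictDerivAt a t).hasDerivAt.const_add z₀)
  refine h1.congr_deriv ?_
  simp only [hv, Pi.neg_apply, Real.exp_neg]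
  have := Real.exp_ne_zero (A t)
  field_simp
  ring

lemma relaxation_unique {z w k u : ℝ → ℝ} {a b : ℝ} (hk : ∀ t ∈ Icc a b, 0 < k t)
    (hz : ∀ t ∈ Icc a b, HasDerivWithinAt z (k t * (u t - z t)) (Icc a b) t)
    (hw : ∀ t ∈ Icc a b, HasDerivWithinAt w (k t * (u t - w t)) (Icc a b) t)
    (ha : w a = z a) {t : ℝ} (ht : t ∈ Icc a b) : w t = z t := by
  have := abs_le_of_relaxation (z := fun s => w s - z s) (u := fun _ => 0) (B := 0) hk
    (fun s hs => ((hw s hs).sub (hz s hs)).congr_deriv (by ring)) (by simp) (by simp [ha]) ht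
  exact sub_eq_zero.1 (abs_nonpos_iff.1 this)

/-! ### Slowly varying small functions of time -/

/-- A positive, nonincreasing, 1-Lipschitz function of time, bounded by `1`. -/
structure IsScale (μ : ℝ → ℝ) : Prop where
  pos : ∀ t, 0 < μ t
  le_one : ∀ t, μ t ≤ 1
  anti : Antitone μ
  lip : ∀ s t, s ≤ t → μ s ≤ μ t + (t - s)

lemma IsScale.continuous {μ : ℝ → ℝ} (hμ : IsScale μ) : Continuous μ := by
  refine (LipschitzWith.of_dist_le_mul (K := 1) fun s t => ?_).continuous
  rw [Real.dist_eq, Real.dist_eq, NNReal.coe_one, one_mul]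
  rcases le_total s t with h | h
  · rw [abs_of_nonneg (sub_nonneg.2 (hμ.anti h)), abs_of_nonpos (sub_nonpos.2 h)]
    linarith [hμ.lip s t h]
  · rw [abs_of_nonpos (sub_nonpos.2 (hμ.anti h)), abs_of_nonneg (sub_nonneg.2 h)]
    linarith [hμ.lip t s h]

lemma exists_isScale_le {m : ℕ → ℝ} (hm : ∀ N, 0 < m N) :
    ∃ μ : ℝ → ℝ, IsScale μ ∧ ∀ N : ℕ, ∀ t, (N : ℝ) ≤ t → μ t ≤ m N := by
  -- Each `g · N` is nonincreasing and 1-Lipschitz, is at most `max (m N) 0` once `t ≥ N`, and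
  -- equals `1` while `t ≤ N - 1`. Hence the infimum over `N` involves only finitely many terms
  -- below `1` and stays positive.
  set g : ℝ → ℕ → ℝ := fun t N => min 1 (max (m N) (N - t)) with hg
  have hg0 : ∀ t N, 0 ≤ g t N := fun t N => le_min zero_le_one ((hm N).le.trans (le_max_left _ _))
  have hbdd : ∀ t, BddBelow (range (g t)) := fun t => ⟨0, by rintro _ ⟨N, rfl⟩; exact hg0 t N⟩
  refine ⟨fun t => ⨅ N, g t N, ⟨fun t => ?_, fun t => ?_, fun s t hst => ?_, fun s t hst => ?_⟩,
    fun N t hN => ?_⟩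
  · obtain ⟨M, hM⟩ := exists_nat_ge (t + 1)
    obtain ⟨c, hc, hcm⟩ : ∃ c, 0 < c ∧ ∀ N < M, c ≤ m N := by
      clear hM
      induction M with
      | zero => exact ⟨1, one_pos, by simp⟩
      | succ M ih =>
        obtain ⟨c, hc, h⟩ := ih
        refine ⟨min c (m M), lt_min hc (hm M), fun N hN => ?_⟩
        rcases Nat.lt_succ_iff_lt_or_eq.1 hN with h' | rfl
        · exact (min_le_left _ _).trans (h N h')
        · exact min_le_right _ _
    refine lt_of_lt_of_le (lt_min one_pos hc) (le_ciInf fun N => le_min (min_le_left _ _) ?_)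
    rcases lt_or_ge N M with h | h
    · exact (min_le_right _ _).trans ((hcm N h).trans (le_max_left _ _))
    · have : (M : ℝ) ≤ N := by exact_mod_cast h
      exact (min_le_left _ _).trans (le_max_of_le_right (by linarith))
  · exact (ciInf_le (hbdd t) 0).trans (min_le_left _ _)
  · exact ciInf_mono (hbdd t) fun N => min_le_min le_rfl (max_le_max le_rfl (by linarith))
  · rw [← sub_le_iff_le_add]
    refine le_ciInf fun N => ?_
    rw [sub_le_iff_le_add]
    refine (ciInf_le (hbdd s) N).trans ?_
    rcases min_choice 1 (max (m N) (N - t)) with h | h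
    · simp only [hg]; rw [h]
      exact (min_le_left _ _).trans (by linarith)
    · simp only [hg]; rw [h]
      refine (min_le_right _ _).trans (max_le ?_ ?_)
      · linarith [le_max_left (m N) (N - t)]
      · linarith [le_max_right (m N) (N - t)]
  · refine (ciInf_le (hbdd t) N).trans ((min_le_right _ _).trans ?_)
    exact max_le le_rfl (by linarith [hm N])

/-- Turns "every sufficiently small `s` works, uniformly on compact time intervals" into a single
scale; all gains are chosen this way. -/
lemma exists_isScale_forall {P : ℝ → ℝ → Prop}
    (h : ∀ N : ℕ, ∃ m, 0 < m ∧ ∀ t : ℝ, 0 ≤ t → t ≤ N + 1 → ∀ s, 0 < s → s ≤ m → P t s) :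
    ∃ μ, IsScale μ ∧ ∀ t, 0 ≤ t → P t (μ t) := by
  choose m hm hP using h
  obtain ⟨μ, hμ, hle⟩ := exists_isScale_le hm
  exact ⟨μ, hμ, fun t ht => hP ⌊t⌋₊ t ht (Nat.lt_floor_add_one t).le _ (hμ.pos t)
    (hle _ _ (Nat.floor_le ht))⟩

/-! ### A time-varying bound for all trajectories -/

section Reach

variable {E : Type*} [NormedAddCommGroup E]

/-- Compactness of the time interval yields one Lipschitz constant on a tube around the trajectory.
-/
lemma LocallyLipschitzInState.exists_uniform {f : ℝ → E → E} (hf : LocallyLipschitzInState f)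
    {x : ℝ → E} {a b : ℝ} (ha : 0 ≤ a) (hx : ContinuousOn x (Icc a b)) :
    ∃ K : ℝ≥0, ∃ ε : ℝ, 0 < ε ∧
      ∀ t ∈ Icc a b, LipschitzOnWith K (f t) (Metric.ball (x t) ε) := by
  have key := isCompact_Icc.induction_on (s := Icc a b)
    (p := fun s => ∃ K : ℝ≥0, ∃ ε : ℝ, 0 < ε ∧
      ∀ t ∈ s, t ∈ Icc a b → LipschitzOnWith K (f t) (Metric.ball (x t) ε))
    ⟨0, 1, one_pos, by simp⟩
    (fun s t hst ⟨K, ε, hε, h⟩ => ⟨K, ε, hε, fun r hr => h r (hst hr)⟩)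
    (by
      rintro s t ⟨K, ε, hε, h⟩ ⟨K', ε', hε', h'⟩
      refine ⟨max K K', min ε ε', lt_min hε hε', ?_⟩
      rintro r (hr | hr) hrI
      · exact ((h r hr hrI).weaken (le_max_left _ _)).mono (Metric.ball_subset_ball (min_le_left _ _))
      · exact ((h' r hr hrI).weaken (le_max_right _ _)).mono
          (Metric.ball_subset_ball (min_le_right _ _)))
    (by
      intro t ht
      obtain ⟨K, ε, hε, h⟩ := hf t (ha.trans ht.1) (x t)
      have h1 : ∀ᶠ s in 𝓝[Icc a b] t, dist (x s) (x t) < ε / 2 :=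
        (hx t ht).eventually (Metric.ball_mem_nhds _ (by positivity))
      have h2 : ∀ᶠ s in 𝓝[Icc a b] t, dist s t < ε :=
        eventually_nhdsWithin_of_eventually_nhds (Metric.ball_mem_nhds _ hε)
      refine ⟨_, h1.and h2, K, ε / 2, by positivity, fun s hs hsI => ?_⟩
      refine (h s (ha.trans hsI.1) (by simpa [Real.dist_eq] using hs.2)).mono fun z hz => ?_
      have := dist_triangle z (x s) (x t)
      have h3 := hs.1
      rw [Metric.mem_ball] at hz ⊢
      linarith)
  obtain ⟨K, ε, hε, h⟩ := key
  exact ⟨K, ε, hε, fun t ht => h t ht ht⟩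

variable [NormedSpace ℝ E]

lemma IsSolutionOn.mono {F : ℝ → E → E} {I J : Set ℝ} {x : ℝ → E} (hx : IsSolutionOn F I x)
    (h : J ⊆ I) : IsSolutionOn F J x := fun t ht => (hx t (h ht)).mono h

lemma LocallyLipschitzInState.exists_near {f : ℝ → E → E} (hf : LocallyLipschitzInState f)
    {x : ℝ → E} {a b : ℝ} (ha : 0 ≤ a) (hx : IsSolutionOn f (Icc a b) x) :
    ∃ δ : ℝ, 0 < δ ∧ ∀ w : ℝ → E, IsSolutionOn f (Icc a b) w → ‖w a - x a‖ < δ →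
      ∀ t ∈ Icc a b, ‖w t - x t‖ ≤ 1 := by
  obtain ⟨K, ε, hε, hK⟩ := hf.exists_uniform ha fun t ht => (hx t ht).continuousWithinAt
  set η : ℝ := min (ε / 2) 1
  have hη : 0 < η := lt_min (by positivity) one_pos
  have hηε : η < ε := (min_le_left _ _).trans_lt (by linarith)
  have hbd : ∀ t ≤ b, η * Real.exp ((K + 1) * (t - b)) ≤ η := fun t ht => by
    refine mul_le_of_le_one_right hη.le (Real.exp_le_one_iff.2 ?_)
    exact mul_nonpos_of_nonneg_of_nonpos (by positivity) (by linarith)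
  -- Grönwall barrier reaching `η` at the final time. It stays inside the Lipschitz tube, and its
  -- rate `K + 1` exceeds `K`, as the strict comparison requires.
  refine ⟨η * Real.exp ((K + 1) * (a - b)), by positivity, fun w hw hwa t ht => ?_⟩
  have key := image_norm_le_of_norm_deriv_right_lt_deriv_boundary (f := fun s => w s - x s)
    (a := a) (b := b)
    (fun s hs => (hw s hs).continuousWithinAt.sub (hx s hs).continuousWithinAt)
    (fun s hs => (hasDerivWithinAt_Ici_of_Icc hs (hw s ⟨hs.1, hs.2.le⟩)).sub
      (hasDerivWithinAt_Ici_of_Icc hs (hx s ⟨hs.1, hs.2.le⟩)))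
    (B := fun s => η * Real.exp ((K + 1) * (s - b)))
    (B' := fun s => η * (Real.exp ((K + 1) * (s - b)) * ((K + 1) * 1)))
    hwa.le
    (fun s => ((((hasDerivAt_id s).sub_const b).const_mul ((K : ℝ) + 1)).exp.const_mul η))
    (by
      intro s hs hws
      have hsI : s ∈ Icc a b := ⟨hs.1, hs.2.le⟩
      have h1 : w s ∈ Metric.ball (x s) ε := by
        rw [Metric.mem_ball, dist_eq_norm, hws]
        exact (hbd s hs.2.le).trans_lt hηε
      have h2 := (hK s hsI).dist_le_mul _ h1 _ (Metric.mem_ball_self hε)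
      rw [dist_eq_norm, dist_eq_norm, hws] at h2
      have h3 : 0 < η * Real.exp ((K + 1) * (s - b)) := by positivity
      nlinarith)
    ht
  exact key.trans ((hbd t ht.2).trans (min_le_right _ _))

lemma exists_bound_of_forwardComplete [ProperSpace E] {f : ℝ → E → E}
    (hf : LocallyLipschitzInState f) (hfc : ForwardComplete f) {t₀ : ℝ} (ht₀ : 0 ≤ t₀) (R T : ℝ) :
    ∃ B : ℝ, ∀ w : ℝ → E, IsSolutionOn f (Ici t₀) w → ‖w t₀‖ ≤ R →
      ∀ t ∈ Icc t₀ T, ‖w t‖ ≤ B := by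
  have key := (isCompact_closedBall (0 : E) R).induction_on
    (p := fun s => ∃ B : ℝ, ∀ w : ℝ → E, IsSolutionOn f (Ici t₀) w → w t₀ ∈ s →
      ∀ t ∈ Icc t₀ T, ‖w t‖ ≤ B)
    ⟨0, by simp⟩
    (fun s t hst ⟨B, h⟩ => ⟨B, fun w hw hws => h w hw (hst hws)⟩)
    (by
      rintro s t ⟨B, h⟩ ⟨B', h'⟩
      refine ⟨max B B', ?_⟩
      rintro w hw (hws | hws) r hr
      · exact (h w hw hws r hr).trans (le_max_left _ _)
      · exact (h' w hw hws r hr).trans (le_max_right _ _))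
    (by
      intro x₀ _
      obtain ⟨x, hx0, hx⟩ := hfc t₀ ht₀ x₀
      have hx' := hx.mono (Icc_subset_Ici_self : Icc t₀ T ⊆ Ici t₀)
      obtain ⟨δ, hδ, h⟩ := hf.exists_near ht₀ hx'
      obtain ⟨B, hB⟩ := isCompact_Icc.exists_bound_of_continuousOn
        (fun t ht => (hx' t ht).continuousWithinAt : ContinuousOn x (Icc t₀ T))
      refine ⟨_, mem_nhdsWithin_of_mem_nhds (Metric.ball_mem_nhds x₀ hδ), B + 1,
        fun w hw hwx t ht => ?_⟩
      have h1 := h w (hw.mono Icc_subset_Ici_self)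
        (by rw [hx0, ← dist_eq_norm]; exact hwx) t ht
      have h2 := norm_le_norm_add_norm_sub (x t) (w t)
      rw [norm_sub_rev] at h2
      linarith [hB t ht])
  obtain ⟨B, h⟩ := key
  exact ⟨B, fun w hw hwR => h w hw (by simpa using hwR)⟩

/-- Diagonal choice: on `[N, N + 1)` the function `b` dominates the trajectories starting in the
ball of radius `N`, which contains any given initial state for large `N`. -/
lemma exists_eventual_bound [ProperSpace E] {f : ℝ → E → E}
    (hf : LocallyLipschitzInState f) (hfc : ForwardComplete f) {t₀ : ℝ} (ht₀ : 0 ≤ t₀) :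
    ∃ b : ℝ → ℝ, IsScale b ∧ ∀ x : ℝ → E, IsSolutionOn f (Ici t₀) x →
      ∃ S, ∀ t, S ≤ t → ‖x t‖ ≤ (b t)⁻¹ := by
  choose B hB using fun N : ℕ => exists_bound_of_forwardComplete hf hfc ht₀ N (N + 1)
  obtain ⟨b, hb, hle⟩ := exists_isScale_le (m := fun N => (|B N| + 1)⁻¹) (fun N => by positivity)
  refine ⟨b, hb, fun x hx => ?_⟩
  obtain ⟨M, hM⟩ := exists_nat_ge ‖x t₀‖
  refine ⟨max t₀ M, fun t ht => ?_⟩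
  have ht1 : t₀ ≤ t := (le_max_left _ _).trans ht
  have ht0 : 0 ≤ t := ht₀.trans ht1
  have hMN : (M : ℝ) ≤ ⌊t⌋₊ := by
    exact_mod_cast Nat.le_floor ((le_max_right _ _).trans ht)
  have h1 := hB ⌊t⌋₊ x hx (hM.trans hMN) t ⟨ht1, (Nat.lt_floor_add_one t).le⟩
  have h2 := hle ⌊t⌋₊ t (Nat.floor_le ht0)
  have h3 := inv_anti₀ (hb.pos t) h2
  rw [inv_inv] at h3
  linarith [le_abs_self (B ⌊t⌋₊)]

end Reach

/-! ### The first-order differentiator -/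

/-- A rate of at least `1 / (8 s³)` acting for a time `s²` damps by this exponential. The constant
is `8⁴ · 4!`, from the quartic term of the exponential series. -/
lemma exp_neg_inv_le {s : ℝ} (hs : 0 < s) : Real.exp (-(8 * s)⁻¹) ≤ 98304 * s ^ 4 := by
  have h1 := Real.pow_div_factorial_le_exp (8 * s)⁻¹ (by positivity) 4
  rw [Real.exp_neg]
  calc (Real.exp (8 * s)⁻¹)⁻¹ ≤ ((8 * s)⁻¹ ^ 4 / (Nat.factorial 4 : ℝ))⁻¹ :=
        inv_anti₀ (by positivity) h1
    _ = 98304 * s ^ 4 := by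
        have : (Nat.factorial 4 : ℝ) = 24 := by norm_num [Nat.factorial]
        rw [this]; field_simp; norm_num

/-- A first-order filter `ż = k⁻³ (u - z)` with slowly varying gain, driven by an approximation `u`
of `ξ` of precision `k⁴`, yields after time `s²` (where `s` is the final value of `k`)
an approximation of the derivative `γ` of `ξ` and an approximation of `ξ`. -/
lemma differentiator_window {k ξ γ u z : ℝ → ℝ} {t s L B ω : ℝ} (hs : 0 < s) (hs1 : s ≤ 1)
    (hkt : k t = s) (hk : ∀ r ∈ Icc (t - s ^ 2) t, s ≤ k r ∧ k r ≤ s + s ^ 2)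
    (hξ : ∀ r ∈ Icc (t - s ^ 2) t, HasDerivWithinAt ξ (γ r) (Icc (t - s ^ 2) t) r)
    (hγ : ∀ r ∈ Icc (t - s ^ 2) t, |γ t - γ r| ≤ ω) (hL : |γ t| ≤ L)
    (hu : ∀ r ∈ Icc (t - s ^ 2) t, |u r - ξ r| ≤ k r ^ 4)
    (hz : ∀ r ∈ Icc (t - s ^ 2) t,
      HasDerivWithinAt z ((k r ^ 3)⁻¹ * (u r - z r)) (Icc (t - s ^ 2) t) r)
    (hzB : |z (t - s ^ 2)| ≤ B) (hξB : |ξ (t - s ^ 2)| ≤ B) :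
    |(s ^ 3)⁻¹ * (u t - z t) - γ t| ≤ s * (17 + 98304 * (2 * B + L) + 24 * L) + 8 * ω ∧
    |z t - ξ t| ≤ s ^ 3 * (s * (17 + 98304 * (2 * B + L) + 24 * L) + 8 * ω + L) := by
  have hs2 : 0 < s ^ 2 := by positivity
  have hs3 : 0 < s ^ 3 := by positivity
  have hs3' : s ^ 3 ≤ 1 := pow_le_one₀ hs.le hs1
  have ht : t ∈ Icc (t - s ^ 2) t := ⟨by linarith, le_rfl⟩
  have hL0 : 0 ≤ L := (abs_nonneg _).trans hL
  have hB0 : 0 ≤ B := (abs_nonneg _).trans hzB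
  have hω0 : 0 ≤ ω := (abs_nonneg _).trans (hγ t ht)
  -- The filter lags behind `ξ` by about `s³ γ`; adding this lag leaves a remainder `w` whose
  -- forcing is small: `3sL` from the gain variation, `ω` from the variation of `γ`, `2s` from the
  -- input error.
  set w : ℝ → ℝ := fun r => z r - ξ r + s ^ 3 * γ t with hw
  have key := abs_le_of_damped (w := w) (k := fun r => (k r ^ 3)⁻¹)
    (d := fun r => ((k r ^ 3)⁻¹ * s ^ 3 - 1) * γ t + (γ t - γ r) + (k r ^ 3)⁻¹ * (u r - ξ r))
    (a := t - s ^ 2) (b := t) (k₀ := (8 * s ^ 3)⁻¹) (D := 3 * s * L + ω + 2 * s)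
    (by positivity) (by positivity)
    (fun r hr => (((hz r hr).sub (hξ r hr)).add_const _).congr_deriv (by simp only [hw]; ring))
    (fun r hr => by
      have hkr : 0 < k r := hs.trans_le (hk r hr).1
      refine inv_anti₀ (by positivity) ?_
      calc k r ^ 3 ≤ (2 * s) ^ 3 := by
            gcongr
            nlinarith [(hk r hr).2]
        _ = 8 * s ^ 3 := by ring)
    (fun r hr => by
      obtain ⟨hk1, hk2⟩ := hk r hr
      have hkr : 0 < k r := hs.trans_le hk1
      have h1 : |((k r ^ 3)⁻¹ * s ^ 3 - 1) * γ t| ≤ 3 * s * L := by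
        rw [abs_mul]
        refine mul_le_mul ?_ hL (abs_nonneg _) (by positivity)
        -- With `q = s / k r ∈ [1 - s, 1]` one has `1 - q³ ≤ 3 (1 - q) ≤ 3 s`.
        have hq : (k r ^ 3)⁻¹ * s ^ 3 = (s / k r) ^ 3 := by field_simp
        have hq1 : s / k r ≤ 1 := (div_le_one hkr).2 hk1
        have hq2 : 1 - s ≤ s / k r := by
          rw [le_div_iff₀ hkr]
          nlinarith
        have hq0 : 0 ≤ s / k r := by positivity
        rw [hq, abs_sub_comm, abs_of_nonneg (sub_nonneg.2 (pow_le_one₀ hq0 hq1))]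
        set q := s / k r
        nlinarith [mul_nonneg hq0 hq0, mul_nonneg (mul_nonneg hq0 hq0) (sub_nonneg.2 hq1),
          mul_nonneg hq0 (sub_nonneg.2 hq1)]
      have h2 : |(k r ^ 3)⁻¹ * (u r - ξ r)| ≤ 2 * s := by
        rw [abs_mul, abs_of_pos (by positivity)]
        calc (k r ^ 3)⁻¹ * |u r - ξ r| ≤ (k r ^ 3)⁻¹ * k r ^ 4 := by gcongr; exact hu r hr
          _ = k r := by field_simp
          _ ≤ 2 * s := by nlinarith
      have h3 := hγ r hr
      exact (abs_add_three _ _ _).trans (by linarith))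
    ht
  have hwc : |w (t - s ^ 2)| ≤ 2 * B + L := by
    have h1 : |s ^ 3 * γ t| ≤ L := by
      rw [abs_mul, abs_of_pos hs3]
      nlinarith [abs_nonneg (γ t)]
    have h2 : |z (t - s ^ 2) - ξ (t - s ^ 2)| ≤ B + B := (abs_sub _ _).trans (by linarith)
    simp only [hw]
    exact (abs_add_le _ _).trans (by linarith)
  have hexp : Real.exp (-(8 * s ^ 3)⁻¹ * (t - (t - s ^ 2))) ≤ 98304 * s ^ 4 := by
    refine le_trans (le_of_eq ?_) (exp_neg_inv_le hs)
    congr 1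
    field_simp
    ring
  have hwt : |w t| ≤ s ^ 3 * (s * (98304 * (2 * B + L)) + 8 * (3 * s * L + ω + 2 * s)) := by
    refine key.trans ?_
    have : (3 * s * L + ω + 2 * s) / (8 * s ^ 3)⁻¹ = s ^ 3 * (8 * (3 * s * L + ω + 2 * s)) := by
      field_simp
    rw [this]
    have h4 : Real.exp (-(8 * s ^ 3)⁻¹ * (t - (t - s ^ 2))) * |w (t - s ^ 2)|
        ≤ 98304 * s ^ 4 * (2 * B + L) := by gcongr
    calc _ ≤ 98304 * s ^ 4 * (2 * B + L) + s ^ 3 * (8 * (3 * s * L + ω + 2 * s)) := by gcongr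
      _ = _ := by ring
  have hut : |u t - ξ t| ≤ s ^ 4 := hkt ▸ hu t ht
  constructor
  · have h5 : (s ^ 3)⁻¹ * (u t - z t) - γ t = (s ^ 3)⁻¹ * (u t - ξ t) - (s ^ 3)⁻¹ * w t := by
      simp only [hw]; field_simp; ring
    have h6 : |(s ^ 3)⁻¹ * (u t - ξ t)| ≤ s := by
      rw [abs_mul, abs_of_pos (by positivity)]
      calc (s ^ 3)⁻¹ * |u t - ξ t| ≤ (s ^ 3)⁻¹ * s ^ 4 := by gcongr
        _ = s := by field_simp
    have h7 : |(s ^ 3)⁻¹ * w t| ≤ s * (98304 * (2 * B + L)) + 8 * (3 * s * L + ω + 2 * s) := by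
      rw [abs_mul, abs_of_pos (by positivity), inv_mul_le_iff₀ hs3]
      exact hwt
    rw [h5]
    exact (abs_sub _ _).trans (by linarith)
  · have h8 : z t - ξ t = w t - s ^ 3 * γ t := by simp only [hw]; ring
    have h9 : |s ^ 3 * γ t| ≤ s ^ 3 * L := by
      rw [abs_mul, abs_of_pos hs3]; gcongr
    rw [h8]
    refine (abs_sub _ _).trans ((add_le_add hwt h9).trans ?_)
    rw [← mul_add]
    refine mul_le_mul_of_nonneg_left ?_ hs3.le
    linarith

variable {n : ℕ}

/-- At time `t`, the filter with final gain `s⁻³` reproduces the `i`-th component of a trajectory of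
`ẋ = g(t, x)` and its derivative up to `θ t`, if the trajectory and the filter obey the bound
`(b t)⁻¹` on the time window `[t - s², t]`. -/
def DifferentiatesAt (g : ℝ → (Fin n → ℝ) → Fin n → ℝ) (b θ : ℝ → ℝ) (i : Fin n) (t s : ℝ) : Prop :=
  ∀ (k u z : ℝ → ℝ) (x : ℝ → Fin n → ℝ), 0 ≤ t - s ^ 2 → k t = s →
    (∀ r ∈ Icc (t - s ^ 2) t, s ≤ k r ∧ k r ≤ s + s ^ 2) →
    IsSolutionOn g (Icc (t - s ^ 2) t) x →
    (∀ r ∈ Icc (t - s ^ 2) t, ‖x r‖ ≤ (b t)⁻¹) → |z (t - s ^ 2)| ≤ (b t)⁻¹ →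
    (∀ r ∈ Icc (t - s ^ 2) t, |u r - x r i| ≤ k r ^ 4) →
    (∀ r ∈ Icc (t - s ^ 2) t,
      HasDerivWithinAt z ((k r ^ 3)⁻¹ * (u r - z r)) (Icc (t - s ^ 2) t) r) →
    |(s ^ 3)⁻¹ * (u t - z t) - g t (x t) i| ≤ θ t ∧ |z t - x t i| ≤ θ t

lemma exists_differentiator {g : ℝ → (Fin n → ℝ) → Fin n → ℝ}
    (hg : Continuous fun p : ℝ × (Fin n → ℝ) => g p.1 p.2) {b θ : ℝ → ℝ} (hb : IsScale b)
    (hθ : IsScale θ) (i : Fin n) :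
    ∃ μ, IsScale μ ∧ ∀ t, 0 ≤ t → μ t ≤ θ t ∧ DifferentiatesAt g b θ i t (μ t) := by
  refine exists_isScale_forall (P := fun t s => s ≤ θ t ∧ DifferentiatesAt g b θ i t s) ?_
  intro N
  set B : ℝ := (b (N + 1))⁻¹ with hB
  have hB0 : 0 < B := inv_pos.2 (hb.pos _)
  have hθ0 := hθ.pos (N + 1)
  set C : Set (ℝ × (Fin n → ℝ)) := Icc 0 (N + 1 : ℝ) ×ˢ Metric.closedBall 0 B with hC
  have hCc : IsCompact C := isCompact_Icc.prod (isCompact_closedBall _ _)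
  obtain ⟨L, hL⟩ := hCc.exists_bound_of_continuousOn hg.continuousOn
  have hL0 : 0 ≤ L := (norm_nonneg _).trans
    (hL (0, 0) ⟨⟨le_rfl, by positivity⟩, Metric.mem_closedBall_self hB0.le⟩)
  obtain ⟨δ, hδ, huc⟩ := Metric.uniformContinuousOn_iff.1
    (hCc.uniformContinuousOn_of_continuous hg.continuousOn) (θ (N + 1) / 16) (by positivity)
  set A : ℝ := 17 + 98304 * (2 * B + L) + 24 * L with hA
  have hA0 : 0 < A := by positivity
  have hAL : 1 + L ≤ A := by simp only [hA]; linarith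
  -- The error `s * A + 8 * ω` with `ω = θ / 16` splits into two halves of `θ`. The bound with `δ`
  -- keeps the displacement in time (`s²`) and in state (`L s²`) over the window below the modulus
  -- of continuity of `g`.
  refine ⟨min 1 (min (θ (N + 1) / (2 * A)) (δ / (2 * (L + 1)))), by positivity, ?_⟩
  intro t ht0 htN s hs hsm
  have hs1 : s ≤ 1 := hsm.trans (min_le_left _ _)
  have hsA : s * A ≤ θ (N + 1) / 2 := by
    have := hsm.trans ((min_le_right _ _).trans (min_le_left _ _))
    rw [le_div_iff₀ (by positivity)] at this
    linarith
  have hsδ : s * (L + 1) ≤ δ / 2 := by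
    have := hsm.trans ((min_le_right _ _).trans (min_le_right _ _))
    rw [le_div_iff₀ (by positivity)] at this
    linarith
  have hθt : θ (N + 1) ≤ θ t := hθ.anti htN
  have hbt : (b t)⁻¹ ≤ B := inv_anti₀ (hb.pos _) (hb.anti htN)
  have hss : s ^ 2 ≤ s := by nlinarith
  refine ⟨by nlinarith, ?_⟩
  intro k u z x ht hkt hk hx hxb hzb hu hz
  have htI : t ∈ Icc (t - s ^ 2) t := ⟨by linarith [sq_nonneg s], le_rfl⟩
  have hmem : ∀ r ∈ Icc (t - s ^ 2) t, (r, x r) ∈ C := fun r hr =>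
    ⟨⟨ht.trans hr.1, hr.2.trans htN⟩, by simpa using (hxb r hr).trans hbt⟩
  have hgL : ∀ r ∈ Icc (t - s ^ 2) t, ‖g r (x r)‖ ≤ L := fun r hr => hL _ (hmem r hr)
  have hosc : ∀ r ∈ Icc (t - s ^ 2) t, |g t (x t) i - g r (x r) i| ≤ θ (N + 1) / 16 := by
    intro r hr
    have h1 : ‖x t - x r‖ ≤ L * ‖t - r‖ :=
      (convex_Icc _ _).norm_image_sub_le_of_norm_hasDerivWithin_le (fun q hq => hx q hq) hgL hr htI
    have h2 : ‖t - r‖ ≤ s ^ 2 := by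
      rw [Real.norm_of_nonneg (sub_nonneg.2 hr.2)]; linarith [hr.1]
    have h3 : dist (t, x t) (r, x r) < δ := by
      rw [Prod.dist_eq, max_lt_iff, dist_eq_norm, dist_eq_norm]
      constructor
      · nlinarith
      · nlinarith [mul_le_mul_of_nonneg_left h2 hL0]
    have h4 := huc _ (hmem t htI) _ (hmem r hr) h3
    exact (dist_le_pi_dist (g t (x t)) (g r (x r)) i).trans h4.le
  have := differentiator_window (ξ := fun r => x r i) (γ := fun r => g r (x r) i) (L := L) (B := B)
    (ω := θ (N + 1) / 16) hs hs1 hkt hk (fun r hr => hasDerivWithinAt_pi.1 (hx r hr) i) hosc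
    ((norm_le_pi_norm (g t (x t)) i).trans (hgL t htI)) hu hz (hzb.trans hbt)
    (((norm_le_pi_norm (x _) i).trans (hxb _ ⟨le_rfl, htI.1⟩)).trans hbt)
  refine ⟨this.1.trans (by linarith), this.2.trans ?_⟩
  have hs3 : s ^ 3 ≤ s := by nlinarith
  have hθ1 := hθ.le_one (N + 1)
  calc _ ≤ s * (s * A + 8 * (θ (N + 1) / 16) + L) := by gcongr
    _ ≤ s * (1 + L) := by gcongr; linarith
    _ ≤ s * A := by gcongr
    _ ≤ θ t := by linarith

/-! ### Saturated inversion of strictly monotone functions -/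

/-- Truncation of a real number to `[-B, B]`. -/
def clip (B y : ℝ) : ℝ := max (-B) (min B y)

lemma abs_clip_le {B : ℝ} (hB : 0 ≤ B) (y : ℝ) : |clip B y| ≤ B :=
  abs_le.2 ⟨le_max_left _ _, max_le (by linarith) (min_le_left _ _)⟩

lemma clip_eq_self {B y : ℝ} (hy : |y| ≤ B) : clip B y = y := by
  rw [clip, min_eq_right (abs_le.1 hy).2, max_eq_right (abs_le.1 hy).1]

lemma clip_mono (B : ℝ) : Monotone (clip B) := fun _ _ h =>
  max_le_max le_rfl (min_le_min le_rfl h)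

lemma sub_clip_mono (B : ℝ) : Monotone fun w => w - clip B w := by
  intro w w' h
  simp only [clip]
  rcases le_total B w with h1 | h1 <;> rcases le_total B w' with h2 | h2 <;>
  rcases le_total (-B) (min B w) with h3 | h3 <;> rcases le_total (-B) (min B w') with h4 | h4 <;>
  simp_all <;> linarith

lemma continuous_clip : Continuous fun p : ℝ × ℝ => clip p.1 p.2 := by
  unfold clip; fun_prop

/-- By monotonicity `c < ψ x q` is equivalent to `H x c < q`, an open condition on `(x, q)`;
likewise for `>`. -/
lemma exists_continuous_implicit {X : Type*} [TopologicalSpace X] {H : X → ℝ → ℝ}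
    (hH : Continuous fun p : X × ℝ => H p.1 p.2) (hmono : ∀ x, StrictMono (H x))
    (hsurj : ∀ x, Function.Surjective (H x)) :
    ∃ ψ : X → ℝ → ℝ, (Continuous fun p : X × ℝ => ψ p.1 p.2) ∧ ∀ x q, H x (ψ x q) = q := by
  choose ψ hψ using hsurj
  refine ⟨ψ, continuous_iff_continuousAt.2 fun ⟨x₀, q₀⟩ => ?_, hψ⟩
  have hc : ∀ c, Continuous fun p : X × ℝ => H p.1 c := fun c =>
    hH.comp (by fun_prop : Continuous fun p : X × ℝ => (p.1, c))
  refine tendsto_order.2 ⟨fun c hcl => ?_, fun c hcl => ?_⟩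
  · have h1 : H x₀ c < q₀ := by
      rw [← hψ x₀ q₀]; exact hmono x₀ hcl
    filter_upwards [((hc c).tendsto (x₀, q₀)).eventually_lt (continuous_snd.tendsto _) h1]
      with p hp
    rw [← hψ p.1 p.2] at hp
    exact (hmono p.1).lt_iff_lt.1 hp
  · have h1 : q₀ < H x₀ c := by
      rw [← hψ x₀ q₀]; exact hmono x₀ hcl
    filter_upwards [(continuous_snd.tendsto _).eventually_lt ((hc c).tendsto (x₀, q₀)) h1]
      with p hp
    rw [← hψ p.1 p.2] at hp
    exact (hmono p.1).lt_iff_lt.1 hp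

/-- `G x` need not be onto, so it is kept only on `[-B x, B x]` and continued with slope `1`, which
gives a bijection of `ℝ` to invert. -/
lemma exists_saturated_inverse {X : Type*} [TopologicalSpace X] {G : X → ℝ → ℝ} {B : X → ℝ}
    (hG : Continuous fun p : X × ℝ => G p.1 p.2)
    (hmono : ∀ x, StrictMono (G x) ∨ StrictAnti (G x)) (hB : Continuous B) (hB0 : ∀ x, 0 < B x) :
    ∃ Φ : X → ℝ → ℝ, (Continuous fun p : X × ℝ => Φ p.1 p.2) ∧ (∀ x p, |Φ x p| ≤ B x) ∧
      ∀ x w, |w| ≤ B x → Φ x (G x w) = w := by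
  -- A continuous factor with the sign of the monotonicity: `σ x * G x` is increasing in both cases.
  set σ : X → ℝ := fun x => G x 1 - G x 0 with hσ
  have hGc : ∀ c, Continuous fun x : X => G x c := fun c =>
    hG.comp (by fun_prop : Continuous fun x : X => (x, c))
  have hσc : Continuous σ := (hGc 1).sub (hGc 0)
  have hσG : ∀ x, StrictMono fun w => σ x * G x w := by
    intro x
    rcases hmono x with h | h
    · exact h.const_mul (sub_pos.2 (h one_pos))
    · intro w w' hw
      exact mul_lt_mul_of_neg_left (h hw) (sub_neg.2 (h one_pos))
  set H : X → ℝ → ℝ := fun x w => σ x * G x (clip (B x) w) + (w - clip (B x) w) with hHdef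
  have hclip : Continuous fun p : X × ℝ => clip (B p.1) p.2 :=
    continuous_clip.comp (by fun_prop : Continuous fun p : X × ℝ => (B p.1, p.2))
  have hH : Continuous fun p : X × ℝ => H p.1 p.2 := by
    have h1 : Continuous fun p : X × ℝ => G p.1 (clip (B p.1) p.2) :=
      hG.comp (continuous_fst.prodMk hclip)
    have h2 : Continuous fun p : X × ℝ => σ p.1 := hσc.comp continuous_fst
    exact (h2.mul h1).add (continuous_snd.sub hclip)
  have hHm : ∀ x, StrictMono (H x) := by
    intro x w w' hw
    rcases (clip_mono (B x) hw.le).lt_or_eq with h | h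
    · exact add_lt_add_of_lt_of_le (hσG x h) (sub_clip_mono (B x) hw.le)
    · simp only [hHdef, h]
      linarith
  have hHs : ∀ x, Function.Surjective (H x) := by
    intro x
    have hc : Continuous (H x) := hH.comp (by fun_prop : Continuous fun w : ℝ => (x, w))
    have hcl : ∀ w, -B x ≤ clip (B x) w ∧ clip (B x) w ≤ B x := fun w =>
      abs_le.1 (abs_clip_le (hB0 x).le w)
    refine hc.surjective ?_ ?_
    · refine tendsto_atTop_mono (f := fun w => w + (σ x * G x (-B x) - B x)) (fun w => ?_)
        (tendsto_atTop_add_const_right _ _ tendsto_id)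
      have := (hσG x).monotone (hcl w).1
      simp only [hHdef] at this ⊢
      linarith [(hcl w).2]
    · refine tendsto_atBot_mono (f := fun w => w + (σ x * G x (B x) + B x)) (fun w => ?_)
        (tendsto_atBot_add_const_right _ _ tendsto_id)
      have := (hσG x).monotone (hcl w).2
      simp only [hHdef] at this ⊢
      linarith [(hcl w).1]
  obtain ⟨ψ, hψc, hψ⟩ := exists_continuous_implicit hH hHm hHs
  refine ⟨fun x p => clip (B x) (ψ x (σ x * p)), ?_, fun x p => abs_clip_le (hB0 x).le _, ?_⟩
  · have h2 : Continuous fun p : X × ℝ => (p.1, σ p.1 * p.2) := by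
      have : Continuous fun p : X × ℝ => σ p.1 := hσc.comp continuous_fst
      fun_prop
    exact continuous_clip.comp ((hB.comp continuous_fst).prodMk (hψc.comp h2))
  · intro x w hw
    have : ψ x (σ x * G x w) = w := by
      apply (hHm x).injective
      rw [hψ]
      simp only [hHdef, clip_eq_self hw, sub_self, add_zero]
    simp only [this, clip_eq_self hw]

/-- `Φ` reconstructs `x j` from `t`, the components `x l`, `l ≤ i`, and `g t x i`. -/
def Reconstructs (g : ℝ → (Fin n → ℝ) → Fin n → ℝ) (b : ℝ → ℝ) (i j : Fin n)
    (Φ : ℝ → (Fin n → ℝ) → ℝ → ℝ) : Prop :=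
  ∀ t ξ x, (∀ l : Fin n, l ≤ i → ξ l = x l) → |x j| ≤ (b t)⁻¹ → Φ t ξ (g t x i) = x j

lemma exists_reconstruction {g : ℝ → (Fin n → ℝ) → Fin n → ℝ}
    (hg : Continuous fun p : ℝ × (Fin n → ℝ) => g p.1 p.2)
    (hgt : ∀ t, ∀ i : Fin n, ∀ x x' : Fin n → ℝ,
      (∀ j : Fin n, (j : ℕ) ≤ i + 1 → x j = x' j) → g t x i = g t x' i)
    (hgm : ∀ t, ∀ i j : Fin n, (j : ℕ) = i + 1 → ∀ x : Fin n → ℝ,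
      StrictMono (fun z => g t (Function.update x j z) i) ∨
      StrictAnti (fun z => g t (Function.update x j z) i))
    {b : ℝ → ℝ} (hb : IsScale b) {i j : Fin n} (hij : (j : ℕ) = i + 1) :
    ∃ Φ : ℝ → (Fin n → ℝ) → ℝ → ℝ,
      (Continuous fun q : (ℝ × (Fin n → ℝ)) × ℝ => Φ q.1.1 q.1.2 q.2) ∧
      (∀ t ξ p, |Φ t ξ p| ≤ (b t)⁻¹) ∧ Reconstructs g b i j Φ := by
  obtain ⟨Φ, hΦ, hΦb, hΦi⟩ := exists_saturated_inverse (X := ℝ × (Fin n → ℝ))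
    (G := fun q w => g q.1 (Function.update q.2 j w) i) (B := fun q => (b q.1)⁻¹)
    (by
      have h1 : Continuous fun p : (ℝ × (Fin n → ℝ)) × ℝ =>
          (p.1.1, Function.update p.1.2 j p.2) :=
        (continuous_fst.comp continuous_fst).prodMk
          ((continuous_snd.comp continuous_fst).update j continuous_snd)
      exact (continuous_apply i).comp (hg.comp h1))
    (fun q => hgm q.1 i j hij q.2)
    ((hb.continuous.comp continuous_fst).inv₀ fun q => (hb.pos _).ne')
    (fun q => inv_pos.2 (hb.pos _))
  refine ⟨fun t ξ p => Φ (t, ξ) p, hΦ, fun t ξ p => hΦb _ _, fun t ξ x hξ hx => ?_⟩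
  have : g t x i = g t (Function.update ξ j (x j)) i := by
    refine hgt t i _ _ fun l hl => ?_
    by_cases hlj : l = j
    · subst hlj; simp
    · rw [Function.update_of_ne hlj, hξ l]
      have : (l : ℕ) ≠ j := fun h => hlj (Fin.ext h)
      exact Fin.le_def.2 (by omega)
  rw [this]
  exact hΦi (t, ξ) (x j) hx

/-- Quantitative form of `Reconstructs` with tolerance `s` for the data. -/
def ReconstructsUpTo (g : ℝ → (Fin n → ℝ) → Fin n → ℝ) (b : ℝ → ℝ) (i j : Fin n)
    (Φ : ℝ → (Fin n → ℝ) → ℝ → ℝ) (ε : ℝ → ℝ) (t s : ℝ) : Prop :=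
  ∀ (x ξ : Fin n → ℝ) (p : ℝ), ‖x‖ ≤ (b t)⁻¹ → ‖ξ‖ ≤ (b t)⁻¹ →
    (∀ l ≤ i, |ξ l - x l| ≤ s) → |p - g t x i| ≤ s → |Φ t ξ p - x j| ≤ ε t

lemma Reconstructs.exists_tolerance {g : ℝ → (Fin n → ℝ) → Fin n → ℝ}
    (hg : Continuous fun p : ℝ × (Fin n → ℝ) => g p.1 p.2) {b μ : ℝ → ℝ} (hb : IsScale b)
    (hμ : IsScale μ) {i j : Fin n} {Φ : ℝ → (Fin n → ℝ) → ℝ → ℝ}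
    (hΦc : Continuous fun q : (ℝ × (Fin n → ℝ)) × ℝ => Φ q.1.1 q.1.2 q.2)
    (hΦ : Reconstructs g b i j Φ) :
    ∃ θ, IsScale θ ∧ ∀ t, 0 ≤ t → θ t ≤ μ t ∧
      ReconstructsUpTo g b i j Φ (fun t => μ t ^ 4) t (θ t) := by
  refine exists_isScale_forall
    (P := fun t s => s ≤ μ t ∧ ReconstructsUpTo g b i j Φ (fun t => μ t ^ 4) t s) fun N => ?_
  set B : ℝ := (b (N + 1))⁻¹ with hB
  have hμ0 := hμ.pos (N + 1)
  obtain ⟨L, hL⟩ := (isCompact_Icc.prod (isCompact_closedBall _ _) : IsCompact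
    (Icc 0 (N + 1 : ℝ) ×ˢ Metric.closedBall (0 : Fin n → ℝ) B)).exists_bound_of_continuousOn
      hg.continuousOn
  set C : Set ((ℝ × (Fin n → ℝ)) × ℝ) :=
    (Icc 0 (N + 1 : ℝ) ×ˢ Metric.closedBall 0 B) ×ˢ Metric.closedBall 0 (L + 1)
  have hCc : IsCompact C :=
    (isCompact_Icc.prod (isCompact_closedBall _ _)).prod (isCompact_closedBall _ _)
  obtain ⟨δ, hδ, huc⟩ := Metric.uniformContinuousOn_iff.1
    (hCc.uniformContinuousOn_of_continuous hΦc.continuousOn) (μ (N + 1) ^ 4) (by positivity)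
  refine ⟨min (μ (N + 1)) (δ / 2), by positivity, fun t ht htN s hs hsm => ⟨?_, ?_⟩⟩
  · exact (hsm.trans (min_le_left _ _)).trans (hμ.anti htN)
  intro x ξ p hx hξ hξx hp
  have hbt : (b t)⁻¹ ≤ B := inv_anti₀ (hb.pos _) (hb.anti htN)
  have hsδ : s < δ := (hsm.trans (min_le_right _ _)).trans_lt (by linarith)
  have hs1 : s ≤ 1 := (hsm.trans (min_le_left _ _)).trans (hμ.le_one _)
  have hgx : |g t x i| ≤ L := (norm_le_pi_norm (g t x) i).trans
    (hL (t, x) ⟨⟨ht, htN⟩, by simpa using hx.trans hbt⟩)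
  -- On this mixed vector `Φ` is exact, and it is `s`-close to `ξ` even though the later entries of
  -- `ξ` are arbitrary; uniform continuity of `Φ` does the rest.
  set ζ : Fin n → ℝ := fun l => if l ≤ i then x l else ξ l with hζ
  have hζB : ‖ζ‖ ≤ B := by
    refine (pi_norm_le_iff_of_nonneg (inv_pos.2 (hb.pos _)).le).2 fun l => ?_
    simp only [hζ]
    split_ifs
    · exact (norm_le_pi_norm x l).trans (hx.trans hbt)
    · exact (norm_le_pi_norm ξ l).trans (hξ.trans hbt)
  have hdist : dist ξ ζ ≤ s := by
    refine (dist_pi_le_iff hs.le).2 fun l => ?_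
    simp only [hζ]
    split_ifs with h
    · exact hξx l h
    · simpa using hs.le
  have h1 : Φ t ζ (g t x i) = x j :=
    hΦ t ζ x (fun l hl => by simp only [hζ, if_pos hl]) ((norm_le_pi_norm x j).trans hx)
  have h2 := huc ((t, ξ), p)
    ⟨⟨⟨ht, htN⟩, by simpa using hξ.trans hbt⟩, by
      rw [mem_closedBall_zero_iff, Real.norm_eq_abs]
      have := abs_sub_abs_le_abs_sub p (g t x i)
      linarith⟩
    ((t, ζ), g t x i)
    ⟨⟨⟨ht, htN⟩, by simpa using hζB⟩, by
      rw [mem_closedBall_zero_iff, Real.norm_eq_abs]; linarith⟩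
    (by
      rw [Prod.dist_eq, Prod.dist_eq, dist_self, max_eq_right dist_nonneg, max_lt_iff]
      exact ⟨hdist.trans_lt hsδ, lt_of_le_of_lt hp hsδ⟩)
  simp only [h1] at h2
  have hμt : μ (N + 1) ≤ μ t := hμ.anti htN
  exact h2.le.trans (pow_le_pow_left₀ hμ0.le hμt 4)

/-- One stage of the cascade: if the components up to `i` are known with precision `μ⁴`, then the
filter with gain `μ⁻³` gives `x i` with precision `μ'` and, through `Φ`, the next component with
precision `μ'⁴`, after a transient of length at most `1`. -/
def IsStage (g : ℝ → (Fin n → ℝ) → Fin n → ℝ) (b : ℝ → ℝ) (i : Fin n)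
    (Φ : ℝ → (Fin n → ℝ) → ℝ → ℝ) (μ μ' : ℝ → ℝ) : Prop :=
  ∀ (a e : ℝ) (x ξ : ℝ → Fin n → ℝ) (z : ℝ → ℝ), 0 ≤ a → IsSolutionOn g (Icc a e) x →
    (∀ t ∈ Icc a e, ‖x t‖ ≤ (b t)⁻¹) → (∀ t ∈ Icc a e, ‖ξ t‖ ≤ (b t)⁻¹) →
    (∀ t ∈ Icc a e, |z t| ≤ (b t)⁻¹) →
    (∀ t ∈ Icc a e, ∀ l ≤ i, |ξ t l - x t l| ≤ μ t ^ 4) →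
    (∀ t ∈ Icc a e, HasDerivWithinAt z ((μ t ^ 3)⁻¹ * (ξ t i - z t)) (Icc a e) t) →
    ∀ t ∈ Icc (a + 1) e, |z t - x t i| ≤ μ' t ∧
      ∀ j : Fin n, (j : ℕ) = i + 1 →
        |Φ t (ξ t) ((μ t ^ 3)⁻¹ * (ξ t i - z t)) - x t j| ≤ μ' t ^ 4

lemma exists_isStage {g : ℝ → (Fin n → ℝ) → Fin n → ℝ}
    (hg : Continuous fun p : ℝ × (Fin n → ℝ) => g p.1 p.2) {b μ' : ℝ → ℝ} (hb : IsScale b)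
    (hμ' : IsScale μ') (i : Fin n) {Φ : ℝ → (Fin n → ℝ) → ℝ → ℝ}
    (hΦc : Continuous fun q : (ℝ × (Fin n → ℝ)) × ℝ => Φ q.1.1 q.1.2 q.2)
    (hΦ : ∀ j : Fin n, (j : ℕ) = i + 1 → Reconstructs g b i j Φ) :
    ∃ μ, IsScale μ ∧ (∀ t, 0 ≤ t → μ t ≤ μ' t) ∧ IsStage g b i Φ μ μ' := by
  obtain ⟨θ, hθ, hθμ, hθΦ⟩ : ∃ θ, IsScale θ ∧ (∀ t, 0 ≤ t → θ t ≤ μ' t) ∧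
      ∀ j : Fin n, (j : ℕ) = i + 1 → ∀ t, 0 ≤ t →
        ReconstructsUpTo g b i j Φ (fun t => μ' t ^ 4) t (θ t) := by
    by_cases h : (i : ℕ) + 1 < n
    · obtain ⟨θ, hθ, h'⟩ := (hΦ ⟨i + 1, h⟩ rfl).exists_tolerance hg hb hμ' hΦc
      refine ⟨θ, hθ, fun t ht => (h' t ht).1, fun j hj t ht => ?_⟩
      obtain rfl : j = ⟨i + 1, h⟩ := Fin.ext hj
      exact (h' t ht).2
    · exact ⟨μ', hμ', fun t _ => le_rfl, fun j hj => absurd (hj ▸ j.2) h⟩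
  obtain ⟨μ, hμ, h⟩ := exists_differentiator hg hb hθ i
  refine ⟨μ, hμ, fun t ht => (h t ht).1.trans (hθμ t ht), ?_⟩
  intro a e x ξ z ha hx hxb hξb hzb hξx hz t ht
  have hμ1 : μ t ^ 2 ≤ 1 := pow_le_one₀ (hμ.pos t).le (hμ.le_one t)
  have hμ2 : 0 < μ t ^ 2 := pow_pos (hμ.pos t) 2
  have ht0 : 0 ≤ t := by linarith [ht.1]
  have htI : t ∈ Icc a e := ⟨by linarith [ht.1], ht.2⟩
  have hsub : Icc (t - μ t ^ 2) t ⊆ Icc a e := Icc_subset_Icc (by linarith [ht.1]) ht.2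
  -- The window has length `μ t ^ 2 ≤ 1`, so it fits after `a`; there the 1-Lipschitz property keeps
  -- `μ` between `s` and `s + s²`, where `s = μ t`.
  obtain ⟨h1, h2⟩ := (h t ht0).2 μ (fun r => ξ r i) z x (by linarith [ht.1]) rfl
    (fun r hr => ⟨hμ.anti hr.2, (hμ.lip r t hr.2).trans (by linarith [hr.1])⟩)
    (hx.mono hsub)
    (fun r hr => (hxb r (hsub hr)).trans (inv_anti₀ (hb.pos _) (hb.anti hr.2)))
    ((hzb _ (hsub ⟨le_rfl, by linarith⟩)).trans (inv_anti₀ (hb.pos _) (hb.anti (by linarith))))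
    (fun r hr => hξx r (hsub hr) i le_rfl) (fun r hr => (hz r (hsub hr)).mono hsub)
  refine ⟨h2.trans (hθμ t ht0), fun j hj => ?_⟩
  refine hθΦ j hj t ht0 (x t) (ξ t) _ (hxb t htI) (hξb t htI) (fun l hl => ?_) h1
  refine (hξx t htI l hl).trans (le_trans ?_ (h t ht0).1)
  exact pow_le_of_le_one (hμ.pos t).le (hμ.le_one t) (by norm_num)

/-! ### The cascade observer -/

section Cascade

variable [NeZero n]

/-- The successive estimates of the state in the cascade: the entries up to `i` of the `i`-th vector
are the estimates of the corresponding components of the state. -/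
noncomputable def estimate (b : ℝ → ℝ) (Φ : ℕ → ℝ → (Fin n → ℝ) → ℝ → ℝ) (μ : ℕ → ℝ → ℝ)
    (t : ℝ) (z : Fin n → ℝ) (y : ℝ) : ℕ → Fin n → ℝ
  | 0 => fun _ => clip (b t)⁻¹ y
  | i + 1 => fun j => if (j : ℕ) ≤ i then estimate b Φ μ t z y i j else
      Φ i t (estimate b Φ μ t z y i)
        ((μ i t ^ 3)⁻¹ * (estimate b Φ μ t z y i (Fin.ofNat n i) - z (Fin.ofNat n i)))

/-- The right-hand side of the cascade observer. -/
noncomputable def cascade (b : ℝ → ℝ) (Φ : ℕ → ℝ → (Fin n → ℝ) → ℝ → ℝ) (μ : ℕ → ℝ → ℝ)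
    (t : ℝ) (z : Fin n → ℝ) (y : ℝ) : Fin n → ℝ := fun j =>
  (μ j t ^ 3)⁻¹ * (estimate b Φ μ t z y j j - z j)

variable {b : ℝ → ℝ} {Φ : ℕ → ℝ → (Fin n → ℝ) → ℝ → ℝ} {μ : ℕ → ℝ → ℝ}

lemma norm_estimate_le (hb : IsScale b) (hΦb : ∀ i t ξ p, |Φ i t ξ p| ≤ (b t)⁻¹)
    (t : ℝ) (z : Fin n → ℝ) (y : ℝ) (i : ℕ) : ‖estimate b Φ μ t z y i‖ ≤ (b t)⁻¹ := by
  have hb0 : 0 ≤ (b t)⁻¹ := (inv_pos.2 (hb.pos t)).le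
  induction i with
  | zero => exact (pi_norm_le_iff_of_nonneg hb0).2 fun j => abs_clip_le hb0 y
  | succ i ih =>
    refine (pi_norm_le_iff_of_nonneg hb0).2 fun j => ?_
    simp only [estimate]
    split_ifs
    · exact (norm_le_pi_norm _ j).trans ih
    · exact hΦb _ _ _ _

lemma estimate_succ_of_le (t : ℝ) (z : Fin n → ℝ) (y : ℝ) {k : ℕ} {j : Fin n} (h : (j : ℕ) ≤ k) :
    estimate b Φ μ t z y (k + 1) j = estimate b Φ μ t z y k j := if_pos h

lemma estimate_succ_next (t : ℝ) (z : Fin n → ℝ) (y : ℝ) {i j : Fin n} (h : (j : ℕ) = i + 1) :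
    estimate b Φ μ t z y (i + 1) j = Φ i t (estimate b Φ μ t z y i)
      ((μ i t ^ 3)⁻¹ * (estimate b Φ μ t z y i i - z i)) := by
  have hi : Fin.ofNat n i = i := Fin.ext (Nat.mod_eq_of_lt i.2)
  have hj : ¬ (j : ℕ) ≤ i := by omega
  simp only [estimate, if_neg hj, hi]

/-- The triangular structure of the observer: the equation of each component is linear in that
component and driven only by earlier ones. -/
lemma estimate_congr {t y : ℝ} {z z' : Fin n → ℝ} {i : ℕ} (h : ∀ l : Fin n, (l : ℕ) < i → z l = z' l) :
    estimate b Φ μ t z y i = estimate b Φ μ t z' y i := by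
  induction i with
  | zero => rfl
  | succ i ih =>
    have h1 : z (Fin.ofNat n i) = z' (Fin.ofNat n i) :=
      h _ ((Nat.mod_le i n).trans_lt (Nat.lt_succ_self i))
    simp only [estimate, ih fun l hl => h l (hl.trans (Nat.lt_succ_self i)), h1]

lemma continuous_gain (hμ : ∀ i, IsScale (μ i)) (i : ℕ) : Continuous fun t => (μ i t ^ 3)⁻¹ :=
  ((hμ i).continuous.pow 3).inv₀ fun t => (pow_pos ((hμ i).pos t) 3).ne'

lemma continuous_estimate (hb : IsScale b) (hμ : ∀ i, IsScale (μ i))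
    (hΦc : ∀ i, Continuous fun q : (ℝ × (Fin n → ℝ)) × ℝ => Φ i q.1.1 q.1.2 q.2) (i : ℕ) :
    Continuous fun q : ℝ × (Fin n → ℝ) × ℝ => estimate b Φ μ q.1 q.2.1 q.2.2 i := by
  induction i with
  | zero =>
    have h1 : Continuous fun t => (b t)⁻¹ := hb.continuous.inv₀ fun t => (hb.pos t).ne'
    exact continuous_pi fun j => continuous_clip.comp
      ((h1.comp continuous_fst).prodMk (continuous_snd.comp continuous_snd))
  | succ i ih =>
    have h1 := continuous_gain hμ i
    have h2 : ∀ l, Continuous fun q : ℝ × (Fin n → ℝ) × ℝ =>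
      estimate b Φ μ q.1 q.2.1 q.2.2 i l := fun l => (continuous_apply l).comp ih
    refine continuous_pi fun j => ?_
    simp only [estimate]
    split_ifs
    · exact h2 j
    · refine (hΦc i).comp ((continuous_fst.prodMk ih).prodMk ?_)
      refine (h1.comp continuous_fst).mul ((h2 _).sub ?_)
      fun_prop

lemma continuous_cascade (hb : IsScale b) (hμ : ∀ i, IsScale (μ i))
    (hΦc : ∀ i, Continuous fun q : (ℝ × (Fin n → ℝ)) × ℝ => Φ i q.1.1 q.1.2 q.2) :
    Continuous fun q : ℝ × (Fin n → ℝ) × ℝ => cascade b Φ μ q.1 q.2.1 q.2.2 := by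
  refine continuous_pi fun j => ((continuous_gain hμ j).comp continuous_fst).mul (Continuous.sub ?_ ?_)
  · exact (continuous_apply j).comp (continuous_estimate hb hμ hΦc j)
  · fun_prop

lemma exists_cascade_solution (hb : IsScale b) (hμ : ∀ i, IsScale (μ i))
    (hΦc : ∀ i, Continuous fun q : (ℝ × (Fin n → ℝ)) × ℝ => Φ i q.1.1 q.1.2 q.2)
    {y : ℝ → ℝ} (hy : Continuous y) (a : ℝ) (z₀ : Fin n → ℝ) :
    ∃ z : ℝ → Fin n → ℝ, z a = z₀ ∧
      ∀ t j, HasDerivAt (fun t => z t j) (cascade b Φ μ t (z t) (y t) j) t := by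
  have key : ∀ k ≤ n, ∃ z : ℝ → Fin n → ℝ, Continuous z ∧ ∀ j : Fin n, (j : ℕ) < k →
      z a j = z₀ j ∧ ∀ t, HasDerivAt (fun t => z t j) (cascade b Φ μ t (z t) (y t) j) t := by
    intro k
    induction k with
    | zero => exact fun _ => ⟨fun _ => z₀, continuous_const, by simp⟩
    | succ k ih =>
      intro hk
      obtain ⟨z, hzc, hz⟩ := ih (by omega)
      set i : Fin n := ⟨k, hk⟩
      have hu : Continuous fun t => estimate b Φ μ t (z t) (y t) k i :=
        (continuous_apply i).comp ((continuous_estimate hb hμ hΦc k).comp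
          (by fun_prop : Continuous fun t => (t, z t, y t)))
      -- The earlier components being known functions of time, component `k` solves a scalar linear
      -- equation; inserting it does not disturb the earlier equations.
      obtain ⟨ζ, hζ0, hζ⟩ := exists_relaxation (continuous_gain hμ k) hu a (z₀ i)
      have hζc : Continuous ζ := continuous_iff_continuousAt.2 fun t => (hζ t).continuousAt
      have hest : ∀ t, ∀ j : Fin n, (j : ℕ) < k + 1 →
          estimate b Φ μ t (Function.update (z t) i (ζ t)) (y t) j =
            estimate b Φ μ t (z t) (y t) j := fun t j hj =>
        estimate_congr fun l hl => Function.update_of_ne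
          (fun h => by rw [h] at hl; simp only [i] at hl; omega) _ _
      refine ⟨fun t => Function.update (z t) i (ζ t), hzc.update i hζc, fun j hj => ?_⟩
      by_cases hji : j = i
      · subst hji
        refine ⟨by simpa using hζ0, fun t => ?_⟩
        simp only [cascade, hest t _ hj, Function.update_self]
        exact hζ t
      · have hjk : (j : ℕ) < k :=
          lt_of_le_of_ne (Nat.lt_succ_iff.1 hj) fun h => hji (Fin.ext h)
        refine ⟨by simpa [hji] using (hz j hjk).1, fun t => ?_⟩
        simp only [cascade, hest t _ hj, Function.update_of_ne hji]
        exact (hz j hjk).2 t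
  obtain ⟨z, -, hz⟩ := key n le_rfl
  exact ⟨z, funext fun j => (hz j j.2).1, fun t j => (hz j j.2).2 t⟩

lemma cascade_unique (hμ : ∀ i, IsScale (μ i)) {y : ℝ → ℝ} {a e : ℝ} {z w : ℝ → Fin n → ℝ}
    (hz : IsSolutionOn (fun t ζ => cascade b Φ μ t ζ (y t)) (Icc a e) z)
    (hw : IsSolutionOn (fun t ζ => cascade b Φ μ t ζ (y t)) (Icc a e) w)
    (ha : w a = z a) : EqOn w z (Icc a e) := by
  have key : ∀ k : ℕ, ∀ j : Fin n, (j : ℕ) = k → ∀ t ∈ Icc a e, w t j = z t j := by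
    intro k
    induction k using Nat.strong_induction_on with
    | _ k ih =>
      intro j hj t ht
      refine relaxation_unique (k := fun t => (μ j t ^ 3)⁻¹)
        (u := fun t => estimate b Φ μ t (z t) (y t) j j)
        (fun s _ => inv_pos.2 (pow_pos ((hμ j).pos s) 3))
        (fun s hs => hasDerivWithinAt_pi.1 (hz s hs) j)
        (fun s hs => (hasDerivWithinAt_pi.1 (hw s hs) j).congr_deriv ?_) (congrFun ha j) ht
      simp only [cascade]
      rw [estimate_congr fun l hl => ih l (hj ▸ hl) l rfl s hs]
  exact fun t ht => funext fun j => key j j rfl t ht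

lemma cascade_bound (hb : IsScale b) (hμ : ∀ i, IsScale (μ i))
    (hΦb : ∀ i t ξ p, |Φ i t ξ p| ≤ (b t)⁻¹) {y : ℝ → ℝ} {a e : ℝ} {z : ℝ → Fin n → ℝ}
    (hz : IsSolutionOn (fun t ζ => cascade b Φ μ t ζ (y t)) (Icc a e) z) (ha : z a = 0)
    (j : Fin n) : ∀ t ∈ Icc a e, |z t j| ≤ (b t)⁻¹ := by
  intro t ht
  -- Since `b⁻¹` is nondecreasing, the constant `(b t)⁻¹` bounds the inputs on all of `[a, t]`.
  have hsub : Icc a t ⊆ Icc a e := Icc_subset_Icc le_rfl ht.2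
  refine abs_le_of_relaxation (k := fun t => (μ j t ^ 3)⁻¹)
    (u := fun t => estimate b Φ μ t (z t) (y t) j j)
    (fun s _ => inv_pos.2 (pow_pos ((hμ j).pos s) 3))
    (fun s hs => hasDerivWithinAt_pi.1 (hz.mono hsub s hs) j) (fun s hs => ?_) ?_
    (right_mem_Icc.2 ht.1)
  · exact ((norm_le_pi_norm _ j).trans (norm_estimate_le hb hΦb _ _ _ _)).trans
      (inv_anti₀ (hb.pos _) (hb.anti hs.2))
  · simpa [ha] using (hb.pos t).le

/-- Each stage costs one time unit. At `s` only bounds are required, not `z s = 0`, so `s` may lie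
after the starting time of the observer. -/
lemma cascade_error (hb : IsScale b) (hμ : ∀ i, IsScale (μ i))
    (hΦb : ∀ i t ξ p, |Φ i t ξ p| ≤ (b t)⁻¹) {g : ℝ → (Fin n → ℝ) → Fin n → ℝ}
    (hle : ∀ i < n, ∀ t, 0 ≤ t → μ i t ≤ μ (i + 1) t)
    (hst : ∀ i : Fin n, IsStage g b i (Φ i) (μ i) (μ (i + 1)))
    {s e : ℝ} (hs : 0 ≤ s) {x z : ℝ → Fin n → ℝ} {y : ℝ → ℝ}
    (hx : IsSolutionOn g (Icc s e) x) (hxb : ∀ t ∈ Icc s e, ‖x t‖ ≤ (b t)⁻¹)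
    (hy : ∀ t ∈ Icc s e, y t = x t 0)
    (hz : IsSolutionOn (fun t ζ => cascade b Φ μ t ζ (y t)) (Icc s e) z)
    (hzb : ∀ j, ∀ t ∈ Icc s e, |z t j| ≤ (b t)⁻¹) :
    ∀ t ∈ Icc (s + n) e, ∀ j, |z t j - x t j| ≤ μ n t := by
  have hsub : ∀ k : ℕ, Icc (s + k) e ⊆ Icc s e := fun k =>
    Icc_subset_Icc (by linarith [k.cast_nonneg (α := ℝ)]) le_rfl
  have stage : ∀ i : Fin n,
      (∀ t ∈ Icc (s + (i : ℕ)) e, ∀ l ≤ i,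
        |estimate b Φ μ t (z t) (y t) i l - x t l| ≤ μ i t ^ 4) →
      ∀ t ∈ Icc (s + (i : ℕ) + 1) e, |z t i - x t i| ≤ μ (i + 1) t ∧
        ∀ j : Fin n, (j : ℕ) = i + 1 →
          |estimate b Φ μ t (z t) (y t) (i + 1) j - x t j| ≤ μ (i + 1) t ^ 4 := by
    intro i hi t ht
    obtain ⟨h1, h2⟩ := hst i (s + (i : ℕ)) e x (fun t => estimate b Φ μ t (z t) (y t) i)
      (fun t => z t i) (by positivity) (hx.mono (hsub i)) (fun t ht => hxb t (hsub i ht))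
      (fun t _ => norm_estimate_le hb hΦb _ _ _ _) (fun t ht => hzb i t (hsub i ht)) hi
      (fun t ht => hasDerivWithinAt_pi.1 (hz.mono (hsub i) t ht) i) t ht
    refine ⟨h1, fun j hj => ?_⟩
    rw [estimate_succ_next _ _ _ hj]
    exact h2 j hj
  have key : ∀ k : ℕ, k < n → ∀ t ∈ Icc (s + k) e, ∀ l : Fin n, (l : ℕ) ≤ k →
      |estimate b Φ μ t (z t) (y t) k l - x t l| ≤ μ k t ^ 4 := by
    intro k
    induction k with
    | zero =>
      intro _ t ht l hl
      have hl0 : l = 0 := Fin.ext (by simpa using hl)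
      have ht' := hsub 0 ht
      rw [hl0, estimate, hy t ht', clip_eq_self ((norm_le_pi_norm (x t) 0).trans (hxb t ht')),
        sub_self, abs_zero]
      exact pow_nonneg ((hμ 0).pos t).le 4
    | succ k ih =>
      intro hk t ht l hl
      have ht1 : t ∈ Icc (s + (k : ℝ) + 1) e := ⟨by have := ht.1; push_cast at this; linarith, ht.2⟩
      have ht0 : 0 ≤ t := by
        have := (hsub (k + 1) ht).1; linarith
      have hih := ih (by omega)
      -- Old entries are inherited, and their precision suffices because `μ k ≤ μ (k + 1)`; only the
      -- last entry comes from a new stage.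
      rcases Nat.le_succ_iff.1 hl with h | h
      · rw [estimate_succ_of_le _ _ _ h]
        refine (hih t ⟨by linarith [ht1.1], ht.2⟩ l h).trans ?_
        exact pow_le_pow_left₀ ((hμ k).pos t).le (hle k (by omega) t ht0) 4
      · exact (stage ⟨k, by omega⟩ (fun t ht l hl => hih t ht l hl) t ht1).2 l h
  have hmono : ∀ t, 0 ≤ t → ∀ k ≤ n, μ k t ≤ μ n t := by
    intro t ht k hk
    induction hk using Nat.decreasingInduction with
    | self => exact le_rfl
    | of_succ k hk ih => exact (hle k hk t ht).trans ih
  intro t ht j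
  have hj : ((j : ℕ) : ℝ) + 1 ≤ n := by exact_mod_cast j.2
  refine (stage j (fun t ht l hl => key j j.2 t ht l hl) t ⟨by linarith [ht.1], ht.2⟩).1.trans ?_
  exact hmono t (by have := (hsub n ht).1; linarith) _ j.2

end Cascade

/-! ### The observer for triangular systems -/

lemma exists_stages {g : ℝ → (Fin n → ℝ) → Fin n → ℝ}
    (hg : Continuous fun p : ℝ × (Fin n → ℝ) => g p.1 p.2)
    (hgt : ∀ t, ∀ i : Fin n, ∀ x x' : Fin n → ℝ,
      (∀ j : Fin n, (j : ℕ) ≤ i + 1 → x j = x' j) → g t x i = g t x' i)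
    (hgm : ∀ t, ∀ i j : Fin n, (j : ℕ) = i + 1 → ∀ x : Fin n → ℝ,
      StrictMono (fun z => g t (Function.update x j z) i) ∨
      StrictAnti (fun z => g t (Function.update x j z) i))
    {b ν : ℝ → ℝ} (hb : IsScale b) (hν : IsScale ν) :
    ∃ (Φ : ℕ → ℝ → (Fin n → ℝ) → ℝ → ℝ) (μ : ℕ → ℝ → ℝ),
      (∀ i, Continuous fun q : (ℝ × (Fin n → ℝ)) × ℝ => Φ i q.1.1 q.1.2 q.2) ∧
      (∀ i t ξ p, |Φ i t ξ p| ≤ (b t)⁻¹) ∧ (∀ i, IsScale (μ i)) ∧ μ n = ν ∧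
      (∀ i < n, ∀ t, 0 ≤ t → μ i t ≤ μ (i + 1) t) ∧
      ∀ i : Fin n, IsStage g b i (Φ i) (μ i) (μ (i + 1)) := by
  have hΦ : ∀ i : ℕ, ∃ Φ : ℝ → (Fin n → ℝ) → ℝ → ℝ,
      (Continuous fun q : (ℝ × (Fin n → ℝ)) × ℝ => Φ q.1.1 q.1.2 q.2) ∧
      (∀ t ξ p, |Φ t ξ p| ≤ (b t)⁻¹) ∧
      ∀ (hi : i < n) (j : Fin n), (j : ℕ) = i + 1 → Reconstructs g b ⟨i, hi⟩ j Φ := by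
    intro i
    by_cases h : i + 1 < n
    · obtain ⟨Φ, h1, h2, h3⟩ := exists_reconstruction hg hgt hgm hb
        (i := ⟨i, by omega⟩) (j := ⟨i + 1, h⟩) rfl
      refine ⟨Φ, h1, h2, fun hi j hj => ?_⟩
      obtain rfl : j = ⟨i + 1, h⟩ := Fin.ext hj
      exact h3
    · exact ⟨fun _ _ _ => 0, continuous_const, fun t _ _ => by simpa using (hb.pos t).le,
        fun hi j hj => absurd (hj ▸ j.2) h⟩
  choose Φ hΦc hΦb hΦr using hΦ
  have hF : ∀ (i : ℕ) (q : {μ // IsScale μ}), ∃ p : {μ // IsScale μ}, ∀ hi : i < n,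
      (∀ t, 0 ≤ t → p.1 t ≤ q.1 t) ∧ IsStage g b ⟨i, hi⟩ (Φ i) p.1 q.1 := by
    intro i q
    by_cases hi : i < n
    · obtain ⟨μ, h1, h2, h3⟩ := exists_isStage hg hb q.2 ⟨i, hi⟩ (hΦc i) (hΦr i hi)
      exact ⟨⟨μ, h1⟩, fun _ => ⟨h2, h3⟩⟩
    · exact ⟨q, fun h => absurd h hi⟩
  choose F hF using hF
  -- Backward recursion: `r k` is the scale of index `n - k`, starting from the final precision `ν`,
  -- since each stage chooses its gain from the precision demanded by the next.
  set r : ℕ → {μ // IsScale μ} := fun k => Nat.rec ⟨ν, hν⟩ (fun k p => F (n - 1 - k) p) k with hr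
  have hstep : ∀ i < n, r (n - i) = F i (r (n - (i + 1))) := by
    intro i hi
    obtain ⟨m, rfl⟩ := Nat.exists_eq_add_of_lt hi
    have h1 : i + m + 1 - i = m + 1 := by omega
    have h2 : i + m + 1 - (i + 1) = m := by omega
    have h3 : i + m + 1 - 1 - m = i := by omega
    rw [h1, h2]
    change F (i + m + 1 - 1 - m) (r m) = _
    rw [h3]
  refine ⟨Φ, fun i => (r (n - i)).1, hΦc, hΦb, fun i => (r (n - i)).2, by simp [hr],
    fun i hi => ?_, fun i => ?_⟩
  · beta_reduce
    rw [hstep i hi]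
    exact (hF i _ hi).1
  · beta_reduce
    rw [hstep i i.2]
    exact (hF i _ i.2).2

lemma IsSolutionOn.ofLp {F : ℝ → EuclideanSpace ℝ (Fin n) → EuclideanSpace ℝ (Fin n)} {I : Set ℝ}
    {x : ℝ → EuclideanSpace ℝ (Fin n)} (hx : IsSolutionOn F I x) :
    IsSolutionOn (fun t ξ => (F t (WithLp.toLp 2 ξ)).ofLp) I (fun t => (x t).ofLp) := fun t ht =>
  (PiLp.hasFDerivAt_ofLp (𝕜 := ℝ) 2 (x t)).comp_hasDerivWithinAt t (hx t ht)

lemma IsSolutionOn.toLp {F : ℝ → EuclideanSpace ℝ (Fin n) → EuclideanSpace ℝ (Fin n)} {I : Set ℝ}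
    {x : ℝ → Fin n → ℝ} (hx : IsSolutionOn (fun t ξ => (F t (WithLp.toLp 2 ξ)).ofLp) I x) :
    IsSolutionOn F I (fun t => WithLp.toLp 2 (x t)) := fun t ht =>
  (PiLp.hasFDerivAt_toLp (𝕜 := ℝ) 2 (x t)).comp_hasDerivWithinAt t (hx t ht)

lemma exists_norm_le_of_coord (n : ℕ) : ∃ C : ℝ, 0 ≤ C ∧ ∀ (v : EuclideanSpace ℝ (Fin n)) (r : ℝ),
    0 ≤ r → (∀ j, |v j| ≤ r) → ‖v‖ ≤ C * r := by
  let L := (PiLp.continuousLinearEquiv 2 ℝ (fun _ : Fin n => ℝ)).symm.toContinuousLinearMap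
  refine ⟨‖L‖, norm_nonneg _, fun v r hr h => (L.le_opNorm v.ofLp).trans ?_⟩
  gcongr
  exact (pi_norm_le_iff_of_nonneg hr).2 h

/-- There is one observer `ż = G(t, z, y)` that, started at any time `a ≥ t₀` in the origin,
approximates every trajectory of a triangular system, with an error `ν t → 0` that does not depend
on `a`. -/
lemma exists_observer (hn : 0 < n)
    {f : ℝ → EuclideanSpace ℝ (Fin n) → EuclideanSpace ℝ (Fin n)}
    (hcont : ContinuousOn (fun p : ℝ × EuclideanSpace ℝ (Fin n) => f p.1 p.2) (Ici 0 ×ˢ univ))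
    (hlip : LocallyLipschitzInState f) (htri : IsTriangular f) (hmono : StrictlyMonotoneInNext f)
    (hfc : ForwardComplete f) {t₀ : ℝ} (ht₀ : 0 ≤ t₀) :
    ∃ G : ℝ → EuclideanSpace ℝ (Fin n) → ℝ → EuclideanSpace ℝ (Fin n),
      (Continuous fun p : ℝ × EuclideanSpace ℝ (Fin n) × ℝ => G p.1 p.2.1 p.2.2) ∧
      (∀ y : ℝ → ℝ, ContinuousOn y (Ici t₀) → ∀ a, t₀ ≤ a → ∀ I ⊆ Ici a,
        ∃ z, IsTheSolutionOn (fun t ζ => G t ζ (y t)) a 0 I z) ∧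
      ∃ ν : ℝ → ℝ, Tendsto ν atTop (𝓝 0) ∧
        ∀ x y, IsTrajectoryWithOutput f (fun _ x => x ⟨0, hn⟩) t₀ univ x y →
          ∃ S, ∀ a, t₀ ≤ a → ∀ e z, z a = 0 →
            IsSolutionOn (fun t ζ => G t ζ (y t)) (Icc a e) z →
            ∀ t ∈ Icc (a + n) e, S ≤ t → ‖x t - z t‖ ≤ ν t := by
  have : NeZero n := ⟨hn.ne'⟩
  -- Freezing `f` at negative times makes the hypotheses hold for all real `t`; the sup norm suits
  -- the componentwise estimates.
  set g : ℝ → (Fin n → ℝ) → Fin n → ℝ := fun t ξ => (f (max t 0) (WithLp.toLp 2 ξ)).ofLp with hgdef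
  have hg : Continuous fun p : ℝ × (Fin n → ℝ) => g p.1 p.2 := by
    refine (PiLp.continuous_ofLp 2 _).comp (hcont.comp_continuous
      (f := fun p : ℝ × (Fin n → ℝ) => (max p.1 0, WithLp.toLp 2 p.2)) ?_ fun p => ?_)
    · exact (continuous_fst.max continuous_const).prodMk
        ((PiLp.continuous_toLp 2 _).comp continuous_snd)
    · exact ⟨le_max_right p.1 0, mem_univ _⟩
  obtain ⟨b, hb, hbx⟩ := exists_eventual_bound hlip hfc ht₀
  obtain ⟨ν, hν, hνN⟩ := exists_isScale_le (m := fun N => 1 / ((N : ℝ) + 1)) fun N => by positivity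
  have hν0 : Tendsto ν atTop (𝓝 0) := by
    refine squeeze_zero' (.of_forall fun t => (hν.pos t).le) ?_
      (tendsto_one_div_add_atTop_nhds_zero_nat.comp (tendsto_nat_floor_atTop (α := ℝ)))
    filter_upwards [eventually_ge_atTop 0] with t ht
    exact hνN _ _ (Nat.floor_le ht)
  obtain ⟨Φ, μ, hΦc, hΦb, hμ, hμn, hle, hst⟩ := exists_stages hg
    (fun t i x x' h => htri _ (le_max_right _ _) i _ _ h)
    (fun t i j hij x => hmono _ (le_max_right _ _) i j hij (WithLp.toLp 2 x)) hb hν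
  obtain ⟨C, hC0, hC⟩ := exists_norm_le_of_coord n
  refine ⟨fun t z y => WithLp.toLp 2 (cascade b Φ μ t z.ofLp y), ?_, ?_, fun t => C * ν t,
    by simpa using hν0.const_mul C, ?_⟩
  · refine (PiLp.continuous_toLp 2 _).comp ((continuous_cascade hb hμ hΦc).comp
      (continuous_fst.prodMk (Continuous.prodMk ?_ (continuous_snd.comp continuous_snd))))
    exact (PiLp.continuous_ofLp 2 _).comp (continuous_fst.comp continuous_snd)
  · intro y hy a ha I hI
    have hy' : Continuous fun t => y (max t a) :=
      hy.comp_continuous (continuous_id.max continuous_const) fun t => ha.trans (le_max_right _ _)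
    obtain ⟨z, hz0, hz⟩ := exists_cascade_solution hb hμ hΦc hy' a 0
    have hzI : IsSolutionOn (fun t ζ => cascade b Φ μ t ζ (y t)) I z := by
      intro t ht
      refine hasDerivWithinAt_pi.2 fun j => ?_
      have := (hz t j).hasDerivWithinAt (s := I)
      rwa [max_eq_left (hI ht)] at this
    refine ⟨fun t => WithLp.toLp 2 (z t), by simp [hz0], hzI.toLp, fun T hT w hw0 hw t ht => ?_⟩
    have := cascade_unique hμ (hzI.mono hT) hw.ofLp (by simp [hw0, hz0]) ht
    exact congrArg (WithLp.toLp 2) this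
  · rintro x y ⟨-, hx, hy⟩
    obtain ⟨S, hS⟩ := hbx x hx
    -- The threshold must not depend on `a`, as restarts need. The `n` stages are counted from `max
    -- a S`, when the observer runs and the trajectory bound holds.
    refine ⟨max S t₀ + n, fun a ha e z hz0 hz t ht hSt => hC _ _ (hν.pos t).le fun j => ?_⟩
    set s := max a S with hs
    have has : a ≤ s := le_max_left _ _
    have hs0 : 0 ≤ s := (ht₀.trans ha).trans has
    have hsub : Icc s e ⊆ Icc a e := Icc_subset_Icc has le_rfl
    have hsI : Icc s e ⊆ Ici t₀ := fun r hr => (ha.trans has).trans hr.1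
    have hxg : IsSolutionOn g (Icc s e) fun t => (x t).ofLp := by
      intro r hr
      have := (hx.mono hsI).ofLp r hr
      simp only [hgdef]
      rwa [max_eq_left (hs0.trans hr.1)]
    have hz' : IsSolutionOn (fun t ζ => cascade b Φ μ t ζ (y t)) (Icc a e)
      fun t => (z t).ofLp := hz.ofLp
    have hzb := cascade_bound hb hμ hΦb hz' (by simp [hz0])
    have := cascade_error hb hμ hΦb hle hst hs0 hxg
      (fun r hr => ((pi_norm_le_iff_of_nonneg (norm_nonneg _)).2 (PiLp.norm_apply_le (x r))).trans
        (hS r ((le_max_right _ _).trans hr.1)))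
      (fun r hr => hy r (hsI hr)) (hz'.mono hsub) (fun j r hr => hzb j r (hsub hr))
      t ⟨by
        rcases max_choice a S with h | h
        · rw [hs, h]; exact ht.1
        · rw [hs, h]; linarith [le_max_left S t₀], ht.2⟩ j
    rw [hμn, abs_sub_comm] at this
    exact this

end ObserverDesign

/-! ### Solvability by periodic restarts and by a single run -/

theorem theorem1p1 (n : ℕ) (hn : 0 < n)
    (f : ℝ → EuclideanSpace ℝ (Fin n) → EuclideanSpace ℝ (Fin n))
    (hcont : ContinuousOn (fun p : ℝ × EuclideanSpace ℝ (Fin n) => f p.1 p.2) (Ici 0 ×ˢ univ))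
    (hlip : ObserverDesign.LocallyLipschitzInState f)
    (htri : ObserverDesign.IsTriangular f)
    (hmono : ObserverDesign.StrictlyMonotoneInNext f)
    (hfc : ObserverDesign.ForwardComplete f) :
    ObserverDesign.SODPSolvable f (fun _ x => x ⟨0, hn⟩) univ ∧
    ∀ R : ℝ, 0 < R →
      ObserverDesign.ODPSolvable f (fun _ x => x ⟨0, hn⟩)
        (Metric.closedBall (0 : EuclideanSpace ℝ (Fin n)) R) := by
  have hyc : ∀ t₀ : ℝ, ∀ M : Set (EuclideanSpace ℝ (Fin n)),
      ∀ y ∈ ObserverDesign.outputSet f (fun _ x => x ⟨0, hn⟩) t₀ M, ContinuousOn y (Ici t₀) := by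
    rintro t₀ M y ⟨x, -, hx, hy⟩
    have hxc : ContinuousOn x (Ici t₀) := fun t ht => (hx t ht).continuousWithinAt
    exact ((EuclideanSpace.proj (𝕜 := ℝ) (⟨0, hn⟩ : Fin n)).continuous.comp_continuousOn hxc).congr hy
  have hn' : (0 : ℝ) < n := by exact_mod_cast hn
  constructor
  · intro t₀ ht₀
    obtain ⟨G, hG, hGz, ν, hν, hGx⟩ :=
      ObserverDesign.exists_observer hn hcont hlip htri hmono hfc ht₀
    -- Truncated subtraction gives `τ 0 = τ 1 = t₀`; the step `n` is the total transient of the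
    -- cascade.
    set τ : ℕ → ℝ := fun k => t₀ + ((k - 1 : ℕ) : ℝ) * n with hτ
    have hτ0 : ∀ k, t₀ ≤ τ k := fun k => by
      have : 0 ≤ ((k - 1 : ℕ) : ℝ) * n := by positivity
      simp only [hτ]; linarith
    refine ⟨τ, by simp [hτ], by simp [hτ], ?_, ?_, fun _ => G, fun _ _ => hG.continuousOn, {0},
      singleton_nonempty _, ?_⟩
    · intro k hk l hl hkl
      have h1 : k - 1 < l - 1 := by
        rw [mem_Ici] at hk hl; omega
      have h2 : ((k - 1 : ℕ) : ℝ) < ((l - 1 : ℕ) : ℝ) := by exact_mod_cast h1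
      simp only [hτ]
      nlinarith
    · exact tendsto_atTop_add_const_left _ _ ((tendsto_natCast_atTop_atTop.comp
        (tendsto_sub_atTop_nat 1)).atTop_mul_const hn')
    · intro ζ₀ hζ₀ y hy
      choose z hz using fun k => hGz y (hyc _ _ y hy) (τ (k - 1)) (hτ0 _)
        (Icc (τ (k - 1)) (τ (k + 1))) Icc_subset_Ici_self
      refine ⟨z, fun k hk => by rw [hζ₀ k hk]; exact hz k, fun Z hZ x hx => ?_⟩
      obtain ⟨S, hS⟩ := hGx x y hx
      refine squeeze_zero_norm' ?_ hν
      filter_upwards [eventually_ge_atTop S, eventually_ge_atTop (t₀ + n)] with t ht htn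
      have h0 : 1 ≤ (t - t₀) / n := by rw [le_div_iff₀ hn']; linarith
      -- At time `t` observer `m + 1` is active. As `m ≥ 1`, it was started at `t₀ + (m - 1) n`,
      -- hence has already run for at least `n` time units.
      set m := ⌊(t - t₀) / n⌋₊ with hm
      have h1 : (m : ℝ) * n ≤ t - t₀ := by
        rw [← le_div_iff₀ hn']; exact Nat.floor_le (by linarith)
      have h2 : t - t₀ < (m + 1 : ℝ) * n := by
        rw [← div_lt_iff₀ hn']; exact Nat.lt_floor_add_one _
      have hm1 : 1 ≤ m := Nat.le_floor (by simpa using h0)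
      have hmc : ((m - 1 : ℕ) : ℝ) = m - 1 := by push_cast [hm1]; ring
      have e0 : τ (m + 1 - 1) = t₀ + (m - 1 : ℝ) * n := by simp [hτ, hmc]
      have e1 : τ (m + 1) = t₀ + m * n := by simp [hτ]
      have e2 : τ (m + 1 + 1) = t₀ + (m + 1 : ℝ) * n := by simp [hτ]
      rw [hZ (m + 1) (by omega) ⟨by rw [e1]; linarith, by rw [e2]; linarith⟩]
      refine hS _ (hτ0 _) _ _ (hz (m + 1)).1 (hz (m + 1)).2.1 t ⟨?_, ?_⟩ ht
      · rw [e0]; linarith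
      · rw [e2]; linarith
  · intro R _ t₀ ht₀
    obtain ⟨G, hG, hGz, ν, hν, hGx⟩ :=
      ObserverDesign.exists_observer hn hcont hlip htri hmono hfc ht₀
    refine ⟨G, hG.continuousOn, {0}, singleton_nonempty _, ?_⟩
    rintro _ rfl y hy
    obtain ⟨z, hz⟩ := hGz y (hyc _ _ y hy) t₀ le_rfl (Ici t₀) subset_rfl
    refine ⟨z, hz, fun x hx => ?_⟩
    obtain ⟨S, hS⟩ := hGx x y ⟨mem_univ _, hx.2⟩
    refine squeeze_zero_norm' ?_ hν
    filter_upwards [eventually_ge_atTop S, eventually_ge_atTop (t₀ + n)] with t ht htn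
    exact hS t₀ le_rfl t z hz.1 (hz.2.1.mono Icc_subset_Ici_self) t ⟨htn, le_rfl⟩ ht
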